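/- **Setting.** Let $d\ge 1$, let $\mathbb S^d\subset\mathbb R^{d+1}$ be the unit sphere with its Lebesgue (surface) measure $\lambda$, and let $\omega_d=\lambda(\mathbb S^d)$. Let $\kappa:[-1,1]\to\mathbb R$ be a $C^1$ function with $\kappa(1)=1$ and $$\kappa(t)=\sum_{q\ge 0}\frac{J_q^2}{q!}\,t^q ,\qquad t\in[-1,1],$$ for real numbers $J_q$, infinitely many of which are nonzero; $\kappa'(1)$ is the one-sided derivative at $1$, and $\kappa_L$ denotes the $L$-fold composition of $\kappa$. Let $T_L=(T_L(x))_{x\in\mathbb S^d}$, $L\ge 1$, be centered Gaussian random fields with (almost surely) continuous paths on a common probability space $(\Omega,\mathcal F,P)$ such that $$\mathrm{Cov}(T_L(x),T_L(y))=\kappa_L(\langle x,y\rangle),\qquad x,y\in\mathbb S^d .$$ Let $a_{00,L}=\int_{\mathbb S^d}T_L(x)\,\omega_d^{-1/2}\,\lambda(dx)$ be the coefficient of $T_L$ along the constant normalized spherical harmonic, so that $a_{00,L}/\sqrt{\omega_d}=\frac1{\omega_d}\int_{\mathbb S^d}T_L\,d\lambda$ is the spherical average of $T_L$. Let $m\ge1$,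 let $x_1,\dots,x_m\in\mathbb S^d$ be pairwise distinct, and write $\underline x=(x_1,\dots,x_m)$, $T_L(\underline x)=(T_L(x_1),\dots,T_L(x_m))$, $\boldsymbol 1=(1,\dots,1)\in\mathbb R^m$. A sequence $(X_L)$ of random vectors in $\mathbb R^m$ satisfies the large deviation principle (LDP) with speed $v_L\to\infty$ and good rate function $I:\mathbb R^m\to[0,\infty]$ ($I$ lower semicontinuous with compact level sets $\{I\le\eta\}$, $\eta\ge 0$) if $\limsup_{L}\frac1{v_L}\log P(X_L\in C)\le-\inf_C I$ for every closed set $C$ and $\liminf_{L}\frac1{v_L}\log P(X_L\in O)\ge-\inf_O I$ for every open set $O$. **Theorem 3.2.** Assume that one of the following holds. * (Low-disorder) $\kappa'(1)<1$; in this case put $v_L=(\kappa'(1))^{-L}$. * (Sparse) $\kappa'(1)=1$ and, for some $c\in\mathbb R\setminus\{0\}$ and $\rho>1$, $\;1-\kappa(t)=\kappa'(1)(1-t)-c(1-t)^\rho+o((1-t)^\rho)$ as $t\to1^-$; in this case put $v_L=L^{1/(\rho-1)}$. Then the limit $$\mathfrak g(t):=\lim_{L\to\infty}v_L\,(1-\kappa_L(t))$$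 exists and is finite for every $t\in[-1,1]$, the function $\mathfrak g(t)(1-t^2)^{\frac d2-1}$ is integrable on $[-1,1]$, and the sequence $$\Big\{T_L(\underline x)-\frac{a_{00,L}}{\sqrt{\omega_d}}\,\boldsymbol 1\Big\}_{L\ge1}$$ satisfies the LDP in $\mathbb R^m$ with speed $v_L$ and good rate function $$I_{2;\mathfrak g}(\underline y;\underline x)=\sup_{\underline\theta\in\mathbb R^m}\Big\{\langle\underline\theta,\underline y\rangle-\frac12\langle\underline\theta,B_{2;\mathfrak g}(\underline x)\,\underline\theta\rangle\Big\},\qquad \underline y\in\mathbb R^m,$$ where $$B_{2;\mathfrak g}(\underline x)=\left(\frac{\int_{-1}^1\mathfrak g(t)(1-t^2)^{\frac d2-1}\,dt}{\int_{-1}^1(1-t^2)^{\frac d2-1}\,dt}-\mathfrak g(\langle x_i,x_j\rangle)\right)_{i,j=1}^m .$$ -/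

import Mathlib

open MeasureTheory ProbabilityTheory Filter Set
open scoped Topology ENNReal Nat

noncomputable section

/-- The unit sphere `S^d` of the Euclidean space `ℝ^(d+1)`. -/
abbrev UnitSphere (d : ℕ) : Type := Metric.sphere (0 : EuclideanSpace ℝ (Fin (d + 1))) 1

/-- The Lebesgue (surface) measure `lambda` on `S^d`. -/
def surfaceMeasure (d : ℕ) : Measure (UnitSphere d) :=
  (volume : Measure (EuclideanSpace ℝ (Fin (d + 1)))).toSphere

/-- The total mass `ω_d` of the surface measure of `S^d`. -/
def sphereArea (d : ℕ) : ℝ := (surfaceMeasure d).real univ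

/-- The scalar product `⟨x, y⟩` of two points of the sphere. -/
def sphereInner {d : ℕ} (x y : UnitSphere d) : ℝ :=
  inner ℝ (x : EuclideanSpace ℝ (Fin (d + 1))) (y : EuclideanSpace ℝ (Fin (d + 1)))

/-! ### Large deviations -/

/-- A rate function: a lower semicontinuous function with values in `[0, ∞]`. -/
structure IsRateFunction {X : Type*} [TopologicalSpace X] (I : X → EReal) : Prop where
  nonneg : ∀ x, 0 ≤ I x
  lowerSemicontinuous : LowerSemicontinuous I

/-- A good rate function: all its level sets are compact. -/
structure IsGoodRateFunction {X : Type*} [TopologicalSpace X] (I : X → EReal) : Prop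
    extends IsRateFunction I where
  isCompact_level : ∀ η : ℝ, 0 ≤ η → IsCompact {x | I x ≤ (η : EReal)}

/-- The large deviation principle with speed `v` and rate function `I` for a sequence `Y` of
random elements of `X` (here `log 0 = -∞` and the infimum over the empty set is `+∞`). -/
structure SatisfiesLDP {Ω : Type*} [MeasurableSpace Ω] {X : Type*} [TopologicalSpace X]
    (P : Measure Ω) (Y : ℕ → Ω → X) (v : ℕ → ℝ) (I : X → EReal) : Prop where
  isRateFunction : IsRateFunction I
  speed_tendsto : Tendsto v atTop atTop
  upper_bound : ∀ C : Set X, IsClosed C →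
    limsup (fun L => ENNReal.log (P {ω | Y L ω ∈ C}) / (v L : EReal)) atTop ≤ -⨅ x ∈ C, I x
  lower_bound : ∀ O : Set X, IsOpen O →
    -⨅ x ∈ O, I x ≤ liminf (fun L => ENNReal.log (P {ω | Y L ω ∈ O}) / (v L : EReal)) atTop

/-! ### The covariance kernel and the fields -/

/-- `κ` is a `C^1` function on `[-1, 1]` with `κ(1) = 1` and `κ(t) = ∑ J_q ^ 2 / q! * t ^ q`, where
infinitely many of the coefficients `J_q` are nonzero. (Only the values on `[-1, 1]` matter.) -/
structure IsCovarianceKernel (κ : ℝ → ℝ) (J : ℕ → ℝ) : Prop where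
  contDiffOn : ContDiffOn ℝ 1 κ (Icc (-1) 1)
  hasSum : ∀ t ∈ Icc (-1 : ℝ) 1, HasSum (fun q : ℕ => J q ^ 2 / (q ! : ℝ) * t ^ q) (κ t)
  infinite : {q | J q ≠ 0}.Infinite
  map_one : κ 1 = 1

/-- The (one-sided) derivative `κ'(1)` of a function on `[-1, 1]`. -/
def derivAtOne (κ : ℝ → ℝ) : ℝ := derivWithin κ (Icc (-1) 1) 1

/-- The covariance regularity assumption: as `t → 1-`,
`1 - κ(t) = κ'(1) (1 - t) - c (1 - t) ^ ρ + o((1 - t) ^ ρ)`, with `c ≠ 0` and `ρ > 1`. -/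
structure CovarianceRegularity (κ : ℝ → ℝ) (c ρ : ℝ) : Prop where
  c_ne_zero : c ≠ 0
  one_lt : 1 < ρ
  isLittleO :
    (fun t : ℝ => (1 - κ t) - (derivAtOne κ * (1 - t) - c * (1 - t) ^ ρ))
      =o[𝓝[<] 1] (fun t : ℝ => (1 - t) ^ ρ)

/-- `T` is a continuous centered Gaussian random field on `S^d` which is isotropic with
`Cov(T(x), T(y)) = k(⟨x, y⟩)`. -/
structure IsIsotropicGaussianField {Ω : Type*} [MeasurableSpace Ω] (P : Measure Ω) {d : ℕ}
    (T : UnitSphere d → Ω → ℝ) (k : ℝ → ℝ) : Prop where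
  isGaussianProcess : IsGaussianProcess T P
  continuous_paths : ∀ᵐ ω ∂P, Continuous fun x => T x ω
  centered : ∀ x, ∫ ω, T x ω ∂P = 0
  covariance : ∀ x y, cov[T x, T y; P] = k (sphereInner x y)

/-- The coefficient `a_00` of the field in its expansion in spherical harmonics, that is, the
`L^2`-product of the path with the constant normalized harmonic `Y_00 = ω_d ^ (-1/2)`. -/
def coeffZero {Ω : Type*} {d : ℕ} (T : UnitSphere d → Ω → ℝ) (ω : Ω) : ℝ :=
  ∫ x, T x ω * (Real.sqrt (sphereArea d))⁻¹ ∂(surfaceMeasure d)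

/-- The random vector `T(x_1, …, x_m) - (a_00 / √ω_d) 1`. -/
def centeredVector {Ω : Type*} {d m : ℕ} (T : UnitSphere d → Ω → ℝ) (x : Fin m → UnitSphere d)
    (ω : Ω) : Fin m → ℝ :=
  fun i => T (x i) ω - coeffZero T ω / Real.sqrt (sphereArea d)

/-! ### The limiting function and the rate function -/

/-- The function `g(t) = lim_L v_L (1 - κ_L(t))`, with `κ_L` the `L`-fold composition of `κ`. -/
def limitFunction (κ : ℝ → ℝ) (v : ℕ → ℝ) (t : ℝ) : ℝ :=
  limUnder atTop fun L : ℕ => v L * (1 - κ^[L] t)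

/-- The weight `(1 - t ^ 2) ^ (d / 2 - 1)`. -/
def sphereWeight (d : ℕ) (t : ℝ) : ℝ := (1 - t ^ 2) ^ ((d : ℝ) / 2 - 1)

/-- The average of `g` over `[-1, 1]` with respect to the weight `(1 - t ^ 2) ^ (d / 2 - 1)`. -/
def weightedAverage (d : ℕ) (g : ℝ → ℝ) : ℝ :=
  (∫ t in (-1 : ℝ)..1, g t * sphereWeight d t) / ∫ t in (-1 : ℝ)..1, sphereWeight d t

/-- The matrix with entries `(weighted average of g) - g(⟨x_i, x_j⟩)`. -/
def matrixB2 {d m : ℕ} (g : ℝ → ℝ) (x : Fin m → UnitSphere d) : Matrix (Fin m) (Fin m) ℝ :=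
  Matrix.of fun i j => weightedAverage d g - g (sphereInner (x i) (x j))

/-- The function `y ↦ sup_θ { ⟨θ, y⟩ - ⟨θ, B θ⟩ / 2 }`, the Legendre transform of the quadratic
form `θ ↦ ⟨θ, B θ⟩ / 2`. -/
def quadraticLegendre {m : ℕ} (B : Matrix (Fin m) (Fin m) ℝ) (y : Fin m → ℝ) : EReal :=
  ⨆ θ : Fin m → ℝ, ((dotProduct θ y - 1 / 2 * dotProduct θ (B.mulVec θ) : ℝ) : EReal)

/-- The conclusion for a given speed `v`: the limiting function `g` exists on `[-1, 1]`, its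
weighted average makes sense, and the vectors obtained by subtracting the spherical average
satisfy the large deviation principle with speed `v` and the good rate function given by the
matrix `matrixB2 g x`. -/
structure CenteredFieldLDP {Ω : Type*} [MeasurableSpace Ω] (P : Measure Ω) {d m : ℕ}
    (T : ℕ → UnitSphere d → Ω → ℝ) (κ : ℝ → ℝ) (x : Fin m → UnitSphere d) (v : ℕ → ℝ) :
    Prop where
  tendsto_limit : ∀ t ∈ Icc (-1 : ℝ) 1,
    Tendsto (fun L : ℕ => v L * (1 - κ^[L] t)) atTop (𝓝 (limitFunction κ v t))
  integrable_limit :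
    IntervalIntegrable (fun t => limitFunction κ v t * sphereWeight d t) volume (-1) 1
  isGoodRateFunction : IsGoodRateFunction (quadraticLegendre (matrixB2 (limitFunction κ v) x))
  ldp : SatisfiesLDP P (fun L => centeredVector (T L) x) v
    (quadraticLegendre (matrixB2 (limitFunction κ v) x))

end

/-!
The proof has four independent ingredients.

*Large deviations.* For vectors `X_L` in `ℝ^m` whose normalized logarithmic moment functions
`v_L⁻¹ log E exp (v_L ⟨θ, X_L⟩)` converge to a quadratic form `⟨θ, B θ⟩ / 2`, the large deviation
principle holds with the Legendre transform of that form
(`satisfiesLDP_quadraticLegendre`). The matrix `B` may be degenerate. The upper bound covers a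
closed set by finitely many half-spaces and uses Chernoff's inequality; the lower bound tilts the
law towards a point `B θ`, which needs only the moment functions and no knowledge of the tilted law.
A point outside the range of `B` has infinite rate.

*Spherical averages.* Under the surface measure a coordinate has density proportional to
`(1 - t ^ 2) ^ (d / 2 - 1)` (`map_sphereInner_surfaceMeasure`). The measure of a set of directions
is a multiple of the volume of the cone over it; that volume is computed in `ℝ × ℝ^d` by the
substitution `s = |w| t / √(1 - t ^ 2)` and the scaling of the volume of `ℝ^d`. Hence the average of
`κ_L (⟨x, ·⟩)` is the weighted average of `κ_L` for every `x`, and the weight is integrable.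

*Iterates of the kernel.* Bernoulli's inequality, applied to each term of the power series, gives
`1 - κ t ≤ κ'(1) (1 - t)` on `[-1, 1]`, strictly for `t < 1`. For `κ'(1) < 1` the sequence
`v_L (1 - κ_L t)` is therefore nonincreasing and bounded by `2`. For `κ'(1) = 1` the numbers
`u_L = 1 - κ_L t` decrease to `0`, and the expansion of `κ` at `1` makes the increments of
`u_L ^ (1 - ρ)` converge, so `v_L u_L` converges by Cesàro means (`tendsto_rpow_mul_of_recursion`). A
comparison with the orbit of `0` makes the bound uniform in `t`.

*The Gaussian vector.* A linear combination of the coordinates of the centered vector is the almost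
sure limit of Riemann sums, which are finite combinations of values of the field; so it is a
centered Gaussian variable with variance `∑ θ_i θ_j (κ_L (⟨x_i, x_j⟩) - average of κ_L)`
(`IsIsotropicGaussianField.map_dotProduct_centeredVector`). No joint measurability of the field is
needed.

Multiplied by `v_L`, the covariance matrix is
`average of v_L (1 - κ_L) - v_L (1 - κ_L (⟨x_i, x_j⟩))`, which converges to `matrixB2` by dominated
convergence.
-/

/-! ### The Legendre transform of a quadratic form -/

theorem dotProduct_sub_le_quadraticLegendre {m : ℕ} (B : Matrix (Fin m) (Fin m) ℝ)
    (y θ : Fin m → ℝ) :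
    ((dotProduct θ y - 1 / 2 * dotProduct θ (B.mulVec θ) : ℝ) : EReal) ≤ quadraticLegendre B y :=
  le_iSup (fun θ : Fin m → ℝ =>
    ((dotProduct θ y - 1 / 2 * dotProduct θ (B.mulVec θ) : ℝ) : EReal)) θ

theorem quadraticLegendre_nonneg {m : ℕ} (B : Matrix (Fin m) (Fin m) ℝ) (y : Fin m → ℝ) :
    0 ≤ quadraticLegendre B y := by
  simpa using dotProduct_sub_le_quadraticLegendre B y 0

theorem continuous_dotProduct_left {m : ℕ} (θ : Fin m → ℝ) :
    Continuous fun y : Fin m → ℝ => dotProduct θ y := by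
  unfold dotProduct; fun_prop

theorem lowerSemicontinuous_quadraticLegendre {m : ℕ} (B : Matrix (Fin m) (Fin m) ℝ) :
    LowerSemicontinuous (quadraticLegendre B) := by
  refine lowerSemicontinuous_iSup fun θ => Continuous.lowerSemicontinuous ?_
  exact continuous_coe_real_ereal.comp ((continuous_dotProduct_left θ).sub continuous_const)

/-- Testing the supremum against `±` the `i`-th basis vector bounds the coordinates of a point by
its rate. -/
theorem abs_apply_le_of_quadraticLegendre_le {m : ℕ} {B : Matrix (Fin m) (Fin m) ℝ}
    {y : Fin m → ℝ} {a : ℝ} (h : quadraticLegendre B y ≤ a) (i : Fin m) :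
    |y i| ≤ a + 1 / 2 * B i i := by
  have key : ∀ s : ℝ, s * y i - 1 / 2 * (s * (s * B i i)) ≤ a := fun s => by
    have := (dotProduct_sub_le_quadraticLegendre B y (Pi.single i s)).trans h
    rw [EReal.coe_le_coe_iff] at this
    simpa [mul_comm, mul_left_comm] using this
  have h1 := key 1
  have h2 := key (-1)
  rw [abs_le]
  constructor <;> linarith

theorem isGoodRateFunction_quadraticLegendre {m : ℕ} (B : Matrix (Fin m) (Fin m) ℝ) :
    IsGoodRateFunction (quadraticLegendre B) where
  nonneg := quadraticLegendre_nonneg B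
  lowerSemicontinuous := lowerSemicontinuous_quadraticLegendre B
  isCompact_level η _ := by
    have hb : {y | quadraticLegendre B y ≤ (η : EReal)} ⊆
        Set.pi univ fun i => Icc (-(η + 1 / 2 * B i i)) (η + 1 / 2 * B i i) := by
      intro y hy i _
      exact abs_le.1 (abs_apply_le_of_quadraticLegendre_le hy i)
    exact (isCompact_univ_pi fun i => isCompact_Icc).of_isClosed_subset
      ((lowerSemicontinuous_quadraticLegendre B).isClosed_preimage (η : EReal)) hb

/-- A vector `y` outside the range of `B` pairs nontrivially with some vector orthogonal to that
range. The quadratic form vanishes on the line it spans, so the supremum along it is infinite. -/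
theorem exists_mulVec_eq_of_quadraticLegendre_le {m : ℕ} {B : Matrix (Fin m) (Fin m) ℝ}
    {y : Fin m → ℝ} {a : ℝ} (h : quadraticLegendre B y ≤ a) :
    ∃ θ, B.mulVec θ = y := by
  by_contra hy
  have hy' : y ∉ LinearMap.range B.mulVecLin := by
    rintro ⟨θ, hθ⟩
    exact hy ⟨θ, by simpa using hθ⟩
  obtain ⟨f, hf, hker⟩ := Submodule.exists_le_ker_of_notMem hy'
  set η : Fin m → ℝ := fun i => f (Pi.single i 1) with hη
  have hfη : ∀ z, f z = dotProduct η z := fun z => by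
    rw [LinearMap.pi_apply_eq_sum_univ f z]
    simp only [dotProduct, hη, smul_eq_mul]
    refine Finset.sum_congr rfl fun i _ => ?_
    rw [mul_comm]
    congr 2
    ext j
    simp [Pi.single_apply, eq_comm]
  have hBη : dotProduct η (B.mulVec η) = 0 := by
    rw [← hfη]
    exact hker ⟨η, by simp⟩
  have hηy : dotProduct η y ≠ 0 := by rwa [← hfη]
  have key : ∀ s : ℝ, s * dotProduct η y ≤ a := fun s => by
    have := (dotProduct_sub_le_quadraticLegendre B y (s • η)).trans h
    rw [EReal.coe_le_coe_iff] at this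
    simpa [Matrix.mulVec_smul, hBη] using this
  have := key ((a + 1) / dotProduct η y)
  rw [div_mul_cancel₀ _ hηy] at this
  linarith

/-! ### The large deviation principle from the convergence of the logarithmic moment functions -/

theorem log_div_le_of_le_exp {p : ℝ≥0∞} {v b : ℝ} (hv : 0 < v)
    (h : p ≤ ENNReal.ofReal (Real.exp (v * b))) : ENNReal.log p / (v : EReal) ≤ b := by
  have h1 := ENNReal.log_monotone h
  rw [ENNReal.log_ofReal_of_pos (Real.exp_pos _), Real.log_exp] at h1
  rw [EReal.div_le_iff_le_mul (by exact_mod_cast hv) (EReal.coe_ne_top _)]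
  exact_mod_cast h1

theorem le_log_div_of_exp_le {p : ℝ≥0∞} {v b : ℝ} (hv : 0 < v)
    (h : ENNReal.ofReal (Real.exp (v * b)) ≤ p) : (b : EReal) ≤ ENNReal.log p / (v : EReal) := by
  have h1 := ENNReal.log_monotone h
  rw [ENNReal.log_ofReal_of_pos (Real.exp_pos _), Real.log_exp] at h1
  rw [EReal.le_div_iff_mul_le (by exact_mod_cast hv) (EReal.coe_ne_top _)]
  rw [mul_comm]
  exact_mod_cast h1

/-- On the exponential scale `v`, a finite sum of exponentials is negligible with respect to an
exponential whose rate is larger than all of theirs. -/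
theorem eventually_sum_exp_lt {ι : Type*} {v : ℕ → ℝ} (hv : Tendsto v atTop atTop)
    (s : Finset ι) {e : ι → ℕ → ℝ} {l : ι → ℝ} {f : ℕ → ℝ} {r : ℝ}
    (he : ∀ i ∈ s, Tendsto (e i) atTop (𝓝 (l i))) (hl : ∀ i ∈ s, l i < r)
    (hf : Tendsto f atTop (𝓝 r)) :
    ∀ᶠ L in atTop, ∑ i ∈ s, Real.exp (v L * e i L) < Real.exp (v L * f L) := by
  have h0 : Tendsto (fun L => ∑ i ∈ s, Real.exp (v L * (e i L - f L))) atTop (𝓝 0) := by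
    rw [← Finset.sum_const_zero (s := s)]
    refine tendsto_finsetSum _ fun i hi => Real.tendsto_exp_atBot.comp ?_
    exact hv.atTop_mul_neg (sub_neg.2 (hl i hi)) ((he i hi).sub hf)
  filter_upwards [h0.eventually_lt_const one_pos] with L hL
  have := mul_lt_mul_of_pos_right hL (Real.exp_pos (v L * f L))
  rw [one_mul, Finset.sum_mul] at this
  refine lt_of_eq_of_lt (Finset.sum_congr rfl fun i _ => ?_) this
  rw [← Real.exp_add]
  ring_nf

/-- The exponential weight `exp (v ⟨θ, X⟩)` splits into the part carried by a cube around `y` and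
the tilted exponential tails in the coordinate directions. -/
theorem exp_le_add_sum_exp_tails {Ω : Type*} {m : ℕ} {v s ε : ℝ} (hv : 0 < v) (hs : 0 ≤ s)
    {Y : Ω → Fin m → ℝ} (θ y : Fin m → ℝ) (ω : Ω) :
    ENNReal.ofReal (Real.exp (v * dotProduct θ (Y ω))) ≤
      {ω | ∀ i, |Y ω i - y i| < ε}.indicator
        (fun _ => ENNReal.ofReal (Real.exp (v * (dotProduct θ y + ε * ∑ i, |θ i|)))) ω +
      ∑ j : Fin m × Bool, ENNReal.ofReal (Real.exp (v * (dotProduct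
        (θ + Pi.single j.1 (if j.2 then s else -s)) (Y ω) +
          (-(if j.2 then s else -s) * y j.1 - s * ε)))) := by
  by_cases hω : ∀ i, |Y ω i - y i| < ε
  · rw [indicator_of_mem (by exact hω)]
    refine le_add_right (ENNReal.ofReal_le_ofReal (Real.exp_le_exp.2 ?_))
    refine mul_le_mul_of_nonneg_left ?_ hv.le
    rw [← sub_le_iff_le_add', ← dotProduct_sub, dotProduct, Finset.mul_sum]
    refine Finset.sum_le_sum fun i _ => ?_
    calc θ i * (Y ω - y) i ≤ |θ i * (Y ω - y) i| := le_abs_self _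
      _ = |Y ω i - y i| * |θ i| := by rw [abs_mul, mul_comm, Pi.sub_apply]
      _ ≤ ε * |θ i| := mul_le_mul_of_nonneg_right (hω i).le (abs_nonneg _)
  · push Not at hω
    obtain ⟨i, hi⟩ := hω
    refine le_add_left ?_
    rcases le_abs'.1 hi with h | h
    · refine le_trans ?_ (Finset.single_le_sum (fun _ _ => zero_le) (Finset.mem_univ (i, false)))
      refine ENNReal.ofReal_le_ofReal (Real.exp_le_exp.2 (mul_le_mul_of_nonneg_left ?_ hv.le))
      simp [add_dotProduct]
      nlinarith
    · refine le_trans ?_ (Finset.single_le_sum (fun _ _ => zero_le) (Finset.mem_univ (i, true)))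
      refine ENNReal.ofReal_le_ofReal (Real.exp_le_exp.2 (mul_le_mul_of_nonneg_left ?_ hv.le))
      simp [add_dotProduct]
      nlinarith

section LDP

variable {Ω : Type*} [MeasurableSpace Ω] {P : Measure Ω} {m : ℕ} {X : ℕ → Ω → Fin m → ℝ}
  {v : ℕ → ℝ} {q : ℕ → (Fin m → ℝ) → ℝ} {B : Matrix (Fin m) (Fin m) ℝ}

theorem AEMeasurable.ofReal_exp_dotProduct {Y : Ω → Fin m → ℝ} (hY : AEMeasurable Y P)
    (θ : Fin m → ℝ) (v c : ℝ) :
    AEMeasurable (fun ω => ENNReal.ofReal (Real.exp (v * (dotProduct θ (Y ω) + c)))) P := by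
  have h := (continuous_dotProduct_left θ).measurable.comp_aemeasurable hY
  simp only [Function.comp_def] at h
  fun_prop

/-- Shifting the exponent by a constant. -/
theorem lintegral_exp_dotProduct_add {Y : Ω → Fin m → ℝ} {v a : ℝ} {θ : Fin m → ℝ}
    (h : ∫⁻ ω, ENNReal.ofReal (Real.exp (v * dotProduct θ (Y ω))) ∂P =
      ENNReal.ofReal (Real.exp (v * a))) (c : ℝ) :
    ∫⁻ ω, ENNReal.ofReal (Real.exp (v * (dotProduct θ (Y ω) + c))) ∂P =
      ENNReal.ofReal (Real.exp (v * (a + c))) := by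
  simp only [mul_add, Real.exp_add, ENNReal.ofReal_mul (Real.exp_pos _).le]
  rw [lintegral_mul_const' _ _ ENNReal.ofReal_ne_top, h]

/-- Chernoff's bound for a half-space. -/
theorem measure_halfSpace_le {Y : Ω → Fin m → ℝ} (hY : AEMeasurable Y P) {v a b : ℝ}
    (hv : 0 < v) {θ : Fin m → ℝ}
    (h : ∫⁻ ω, ENNReal.ofReal (Real.exp (v * dotProduct θ (Y ω))) ∂P =
      ENNReal.ofReal (Real.exp (v * a))) :
    P {ω | b < dotProduct θ (Y ω)} ≤ ENNReal.ofReal (Real.exp (v * (a - b))) := by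
  have h1 := mul_meas_ge_le_lintegral₀ (hY.ofReal_exp_dotProduct θ v (-b)) 1
  rw [lintegral_exp_dotProduct_add h, one_mul, ← sub_eq_add_neg] at h1
  refine (measure_mono fun ω hω => ?_).trans h1
  simp only [mem_ofPred_eq, ENNReal.one_le_ofReal, Real.one_le_exp_iff] at hω ⊢
  exact mul_nonneg hv.le (by linarith)

/-- A closed set on which the rate exceeds `a` is covered by finitely many open half-spaces
`{y | ⟨θ, y⟩ - ⟨θ, B θ⟩ / 2 > a}`: compactness deals with a large cube, and the half-spaces given
by `±` the basis vectors cover its complement. -/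
theorem exists_finset_halfSpace_cover {C : Set (Fin m → ℝ)} (hC : IsClosed C) {a : ℝ}
    (ha : ∀ y ∈ C, (a : EReal) < quadraticLegendre B y) :
    ∃ F : Finset (Fin m → ℝ), ∀ y ∈ C, ∃ θ ∈ F,
      a + 1 / 2 * dotProduct θ (B.mulVec θ) < dotProduct θ y := by
  classical
  set K : Set (Fin m → ℝ) :=
    Set.pi univ fun i => Icc (-(a + 1 / 2 * B i i)) (a + 1 / 2 * B i i)
  have hK : IsCompact (K ∩ C) := (isCompact_univ_pi fun i => isCompact_Icc).inter_right hC
  obtain ⟨F, hF⟩ := hK.elim_finite_subcover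
    (fun θ : Fin m → ℝ => {y | a + 1 / 2 * dotProduct θ (B.mulVec θ) < dotProduct θ y})
    (fun θ => isOpen_lt continuous_const (continuous_dotProduct_left θ)) (by
      rintro y ⟨-, hy⟩
      obtain ⟨θ, hθ⟩ := lt_iSup_iff.1 (ha y hy)
      refine mem_iUnion.2 ⟨θ, ?_⟩
      rw [EReal.coe_lt_coe_iff] at hθ
      rw [mem_ofPred_eq]
      linarith)
  refine ⟨F ∪ (Finset.univ.image (fun i => Pi.single i 1) ∪
    Finset.univ.image (fun i => Pi.single i (-1))), fun y hy => ?_⟩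
  by_cases hyK : y ∈ K
  · obtain ⟨θ, hθF, hθ⟩ := mem_iUnion₂.1 (hF ⟨hyK, hy⟩)
    exact ⟨θ, Finset.mem_union_left _ hθF, hθ⟩
  · simp only [K, Set.mem_pi, mem_univ, true_imp_iff, not_forall] at hyK
    obtain ⟨i, hi⟩ := hyK
    rw [mem_Icc, not_and_or, not_le, not_le] at hi
    rcases hi with hi | hi
    · refine ⟨Pi.single i (-1), by simp, ?_⟩
      simp
      linarith
    · refine ⟨Pi.single i 1, by simp, ?_⟩
      simp
      linarith

theorem ldp_upper_bound (hv : Tendsto v atTop atTop) (hX : ∀ᶠ L in atTop, AEMeasurable (X L) P)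
    (hmgf : ∀ᶠ L in atTop, ∀ θ, ∫⁻ ω, ENNReal.ofReal (Real.exp (v L * dotProduct θ (X L ω))) ∂P =
      ENNReal.ofReal (Real.exp (v L * q L θ)))
    (hq : ∀ θ, Tendsto (fun L => q L θ) atTop (𝓝 (1 / 2 * dotProduct θ (B.mulVec θ))))
    {C : Set (Fin m → ℝ)} (hC : IsClosed C) :
    limsup (fun L => ENNReal.log (P {ω | X L ω ∈ C}) / (v L : EReal)) atTop ≤
      -⨅ y ∈ C, quadraticLegendre B y := by
  refine le_of_forall_gt fun c hc => ?_
  obtain ⟨b, hb, hbc⟩ := EReal.lt_iff_exists_real_btwn.1 hc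
  obtain ⟨a', ha', hab⟩ := EReal.lt_iff_exists_real_btwn.1 hb
  rw [EReal.coe_lt_coe_iff] at hab
  have ha : ∀ y ∈ C, ((-a' : ℝ) : EReal) < quadraticLegendre B y := fun y hy => by
    rw [EReal.coe_neg]
    exact (EReal.neg_lt_comm.1 ha').trans_le (iInf₂_le y hy)
  obtain ⟨F, hF⟩ := exists_finset_halfSpace_cover hC ha
  refine (limsup_le_of_le (by isBoundedDefault) ?_).trans_lt hbc
  have hsum := eventually_sum_exp_lt hv F
    (e := fun θ L => q L θ - (-a' + 1 / 2 * dotProduct θ (B.mulVec θ))) (l := fun _ => a')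
    (f := fun _ => b) (r := b)
    (fun θ _ => by simpa using (hq θ).sub_const (-a' + 1 / 2 * dotProduct θ (B.mulVec θ)))
    (fun _ _ => hab) tendsto_const_nhds
  filter_upwards [hX, hmgf, hsum, hv.eventually_gt_atTop 0] with L hXL hL hs hvL
  refine log_div_le_of_le_exp hvL ?_
  calc P {ω | X L ω ∈ C}
      ≤ P (⋃ θ ∈ F, {ω | -a' + 1 / 2 * dotProduct θ (B.mulVec θ) < dotProduct θ (X L ω)}) :=
        measure_mono fun ω hω => by
          obtain ⟨θ, hθ, h⟩ := hF _ hω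
          exact mem_iUnion₂.2 ⟨θ, hθ, h⟩
    _ ≤ ∑ θ ∈ F, P {ω | -a' + 1 / 2 * dotProduct θ (B.mulVec θ) < dotProduct θ (X L ω)} :=
        measure_biUnion_finset_le _ _
    _ ≤ ∑ θ ∈ F, ENNReal.ofReal
          (Real.exp (v L * (q L θ - (-a' + 1 / 2 * dotProduct θ (B.mulVec θ))))) :=
        Finset.sum_le_sum fun θ _ => measure_halfSpace_le hXL hvL (hL θ)
    _ = ENNReal.ofReal (∑ θ ∈ F,
          Real.exp (v L * (q L θ - (-a' + 1 / 2 * dotProduct θ (B.mulVec θ))))) :=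
        (ENNReal.ofReal_sum_of_nonneg fun _ _ => (Real.exp_pos _).le).symm
    _ ≤ _ := ENNReal.ofReal_le_ofReal hs.le

/-- The quadratic form of a symmetric matrix at a perturbation in a coordinate direction. -/
theorem dotProduct_mulVec_add_single (hB : B.IsSymm) (θ : Fin m → ℝ) (i : Fin m) (s : ℝ) :
    dotProduct (θ + Pi.single i s) (B.mulVec (θ + Pi.single i s)) =
      dotProduct θ (B.mulVec θ) + 2 * s * B.mulVec θ i + s ^ 2 * B i i := by
  have h : dotProduct θ (B.mulVec (Pi.single i s)) = s * B.mulVec θ i := by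
    rw [Matrix.dotProduct_mulVec, dotProduct_single, ← Matrix.mulVec_transpose, hB.eq, mul_comm]
  rw [Matrix.mulVec_add, add_dotProduct, dotProduct_add, dotProduct_add, h]
  simp
  ring

theorem ldp_lower_bound [IsFiniteMeasure P] (hB : B.IsSymm) (hv : Tendsto v atTop atTop)
    (hX : ∀ᶠ L in atTop, AEMeasurable (X L) P)
    (hmgf : ∀ᶠ L in atTop, ∀ θ, ∫⁻ ω, ENNReal.ofReal (Real.exp (v L * dotProduct θ (X L ω))) ∂P =
      ENNReal.ofReal (Real.exp (v L * q L θ)))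
    (hq : ∀ θ, Tendsto (fun L => q L θ) atTop (𝓝 (1 / 2 * dotProduct θ (B.mulVec θ))))
    {O : Set (Fin m → ℝ)} (hO : IsOpen O) :
    -⨅ y ∈ O, quadraticLegendre B y ≤
      liminf (fun L => ENNReal.log (P {ω | X L ω ∈ O}) / (v L : EReal)) atTop := by
  refine le_of_forall_lt fun c hc => ?_
  obtain ⟨b, hcb, hb⟩ := EReal.lt_iff_exists_real_btwn.1 hc
  obtain ⟨y, hyO, hy⟩ := by
    simpa only [iInf_lt_iff, exists_prop] using EReal.lt_neg_comm.1 hb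
  rw [← EReal.coe_neg] at hy
  obtain ⟨θ, rfl⟩ := exists_mulVec_eq_of_quadraticLegendre_le hy.le
  set y := B.mulVec θ with hydef
  set r := 1 / 2 * dotProduct θ y with hr
  have hrb : r < -b := by
    have := (dotProduct_sub_le_quadraticLegendre B y θ).trans_lt hy
    rw [EReal.coe_lt_coe_iff] at this
    linarith
  refine hcb.trans_le (le_liminf_of_le (by isBoundedDefault) ?_)
  -- a cube around `y` inside `O`, so small that `θ` varies little on it
  obtain ⟨ε₁, hε₁, hball⟩ := Metric.isOpen_iff.1 hO y hyO
  obtain ⟨ε, hε, hεε₁, hεθ⟩ : ∃ ε > 0, ε ≤ ε₁ ∧ ε * ∑ i, |θ i| < -b - r := by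
    have hS : 0 ≤ ∑ i, |θ i| := Finset.sum_nonneg fun _ _ => abs_nonneg _
    refine ⟨min ε₁ ((-b - r) / (∑ i, |θ i| + 1)), lt_min hε₁ (div_pos (by linarith) (by linarith)),
      min_le_left _ _, ?_⟩
    calc min ε₁ ((-b - r) / (∑ i, |θ i| + 1)) * ∑ i, |θ i|
        ≤ (-b - r) / (∑ i, |θ i| + 1) * ∑ i, |θ i| :=
          mul_le_mul_of_nonneg_right (min_le_right _ _) hS
      _ < -b - r := by
          rw [div_mul_eq_mul_div, div_lt_iff₀ (by linarith)]
          nlinarith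
  -- a tilt `s` so small that the quadratic gain is beaten by the linear loss
  obtain ⟨s, hs, hsB⟩ : ∃ s > 0, ∀ i, 1 / 2 * s * B i i < ε := by
    have hS : 0 ≤ ∑ i, |B i i| := Finset.sum_nonneg fun _ _ => abs_nonneg _
    refine ⟨ε / (∑ i, |B i i| + 1), div_pos hε (by linarith), fun i => ?_⟩
    have h1 : B i i ≤ ∑ i, |B i i| := (le_abs_self _).trans
      (Finset.single_le_sum (f := fun i => |B i i|) (fun _ _ => abs_nonneg _) (Finset.mem_univ i))
    rw [← mul_div_assoc, div_mul_eq_mul_div, div_lt_iff₀ (by linarith)]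
    nlinarith
  have hsum := eventually_sum_exp_lt hv (Finset.univ : Finset (Option (Fin m × Bool)))
    (e := fun j L => j.elim (dotProduct θ y + ε * ∑ i, |θ i| + b) fun j =>
      q L (θ + Pi.single j.1 (if j.2 then s else -s)) +
        (-(if j.2 then s else -s) * y j.1 - s * ε))
    (l := fun j => j.elim (dotProduct θ y + ε * ∑ i, |θ i| + b) fun j =>
      1 / 2 * dotProduct (θ + Pi.single j.1 (if j.2 then s else -s))
        (B.mulVec (θ + Pi.single j.1 (if j.2 then s else -s))) +
        (-(if j.2 then s else -s) * y j.1 - s * ε))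
    (f := fun L => q L θ) (r := r)
    (by
      rintro (_ | j) -
      · exact tendsto_const_nhds
      · exact (hq _).add_const _)
    (by
      rintro (_ | ⟨i, σ⟩) -
      · simp only [Option.elim_none]
        linarith
      · have := hsB i
        simp only [Option.elim_some, dotProduct_mulVec_add_single hB, ← hydef]
        cases σ <;> simp <;> nlinarith)
    (hq θ)
  filter_upwards [hX, hmgf, hsum, hv.eventually_gt_atTop 0] with L hXL hL hsL hvL
  refine le_log_div_of_exp_le hvL ?_
  have hsub : P {ω | ∀ i, |X L ω i - y i| < ε} ≤ P {ω | X L ω ∈ O} :=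
    measure_mono fun ω hω => hball <| Metric.ball_subset_ball hεε₁ <| by
      rw [Metric.mem_ball, dist_pi_lt_iff hε]
      exact hω
  refine le_trans ?_ hsub
  by_contra hlt
  rw [not_le] at hlt
  have hsplit := lintegral_mono (μ := P)
    (exp_le_add_sum_exp_tails (ε := ε) (Y := X L) hvL hs.le θ y)
  rw [hL θ, lintegral_add_right' _ (Finset.aemeasurable_fun_sum _ fun j _ =>
    hXL.ofReal_exp_dotProduct _ _ _), lintegral_finsetSum' _ fun j _ =>
    hXL.ofReal_exp_dotProduct _ _ _] at hsplit
  have hfst : ∫⁻ ω, {ω | ∀ i, |X L ω i - y i| < ε}.indicator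
      (fun _ => ENNReal.ofReal (Real.exp (v L * (dotProduct θ y + ε * ∑ i, |θ i|)))) ω ∂P ≤
      ENNReal.ofReal (Real.exp (v L * (dotProduct θ y + ε * ∑ i, |θ i| + b))) := by
    refine (lintegral_indicator_const_le _ _).trans ?_
    rw [mul_add _ _ b, Real.exp_add, ENNReal.ofReal_mul (Real.exp_pos _).le]
    gcongr
  have htot := hsplit.trans (add_le_add_left hfst _)
  simp only [lintegral_exp_dotProduct_add (hL _)] at htot
  rw [← ENNReal.ofReal_sum_of_nonneg fun _ _ => (Real.exp_pos _).le,
    ← ENNReal.ofReal_add (Real.exp_pos _).le (Finset.sum_nonneg fun _ _ => (Real.exp_pos _).le),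
    ENNReal.ofReal_le_ofReal_iff (by positivity)] at htot
  rw [Fintype.sum_option] at hsL
  exact absurd hsL (not_lt.2 htot)

/-- A Gärtner–Ellis theorem for quadratic limits: if the normalized logarithmic moment functions
`q L` of the vectors `X L` converge pointwise to `θ ↦ ⟨θ, B θ⟩ / 2` with `B` symmetric, possibly
degenerate, then the large deviation principle holds with the Legendre transform of the limit. -/
theorem satisfiesLDP_quadraticLegendre [IsFiniteMeasure P] (hB : B.IsSymm)
    (hv : Tendsto v atTop atTop) (hX : ∀ᶠ L in atTop, AEMeasurable (X L) P)
    (hmgf : ∀ᶠ L in atTop, ∀ θ, ∫⁻ ω, ENNReal.ofReal (Real.exp (v L * dotProduct θ (X L ω))) ∂P =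
      ENNReal.ofReal (Real.exp (v L * q L θ)))
    (hq : ∀ θ, Tendsto (fun L => q L θ) atTop (𝓝 (1 / 2 * dotProduct θ (B.mulVec θ)))) :
    SatisfiesLDP P X v (quadraticLegendre B) where
  isRateFunction := (isGoodRateFunction_quadraticLegendre B).toIsRateFunction
  speed_tendsto := hv
  upper_bound _ hC := ldp_upper_bound hv hX hmgf hq hC
  lower_bound _ hO := ldp_lower_bound hB hv hX hmgf hq hO

end LDP

/-! ### The law of a coordinate under the surface measure of the sphere -/

theorem hasDerivAt_div_sqrt_one_sub_sq (ρ : ℝ) {t : ℝ} (ht : t ∈ Ioo (-1 : ℝ) 1) :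
    HasDerivAt (fun t => ρ * t / √(1 - t ^ 2)) (ρ * (√(1 - t ^ 2) ^ 3)⁻¹) t := by
  have h0 : 0 < 1 - t ^ 2 := by nlinarith [ht.1, ht.2]
  have ha := Real.sqrt_pos.2 h0
  have h1 : HasDerivAt (fun t : ℝ => √(1 - t ^ 2)) (-(2 * t) / (2 * √(1 - t ^ 2))) t := by
    refine HasDerivAt.sqrt ?_ h0.ne'
    simpa using (hasDerivAt_pow 2 t).const_sub 1
  refine (((hasDerivAt_id' t).const_mul ρ).fun_div h1 ha.ne').congr_deriv ?_
  have h2 := Real.sq_sqrt h0.le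
  generalize √(1 - t ^ 2) = a at *
  field_simp
  linear_combination ρ * h2

/-- With `ρ > 0`, the map `s ↦ s / √(s ^ 2 + ρ ^ 2)` is inverted by `t ↦ ρ t / √(1 - t ^ 2)`. -/
theorem sqrt_sq_add_sq_of_div_sqrt {ρ t : ℝ} (hρ : 0 < ρ) (ht : t ∈ Ioo (-1 : ℝ) 1) :
    √((ρ * t / √(1 - t ^ 2)) ^ 2 + ρ ^ 2) = ρ / √(1 - t ^ 2) := by
  have h0 : 0 < 1 - t ^ 2 := by nlinarith [ht.1, ht.2]
  have ha := Real.sqrt_pos.2 h0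
  have h2 := Real.sq_sqrt h0.le
  rw [Real.sqrt_eq_iff_mul_self_eq (by positivity) (by positivity)]
  set a := √(1 - t ^ 2)
  field_simp
  linear_combination h2

theorem div_sqrt_sq_add_sq_mem_Ioo {ρ : ℝ} (hρ : 0 < ρ) (s : ℝ) :
    s / √(s ^ 2 + ρ ^ 2) ∈ Ioo (-1 : ℝ) 1 := by
  have h0 : 0 < s ^ 2 + ρ ^ 2 := by positivity
  have ha := Real.sqrt_pos.2 h0
  have h := abs_lt.1 (Real.lt_sqrt_of_sq_lt (x := |s|) (y := s ^ 2 + ρ ^ 2)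
    (by rw [sq_abs]; nlinarith))
  constructor
  · rw [lt_div_iff₀ ha]; linarith [h.1]
  · rw [div_lt_iff₀ ha]; linarith [h.2]

theorem div_sqrt_one_sub_sq_of_div_sqrt {ρ : ℝ} (hρ : 0 < ρ) (s : ℝ) :
    ρ * (s / √(s ^ 2 + ρ ^ 2)) / √(1 - (s / √(s ^ 2 + ρ ^ 2)) ^ 2) = s := by
  have h0 : 0 < s ^ 2 + ρ ^ 2 := by positivity
  have ha := Real.sqrt_pos.2 h0
  have h2 := Real.sq_sqrt h0.le
  have h3 : √(1 - (s / √(s ^ 2 + ρ ^ 2)) ^ 2) = ρ / √(s ^ 2 + ρ ^ 2) := by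
    rw [Real.sqrt_eq_iff_mul_self_eq _ (by positivity)]
    · set a := √(s ^ 2 + ρ ^ 2)
      field_simp
      linear_combination h2
    · have := div_sqrt_sq_add_sq_mem_Ioo hρ s
      nlinarith [this.1, this.2]
  rw [h3]
  field_simp

/-- The substitution `s = ρ t / √(1 - t ^ 2)`, in which `s / √(s ^ 2 + ρ ^ 2)` is the new
variable. -/
theorem lintegral_comp_div_sqrt {ρ : ℝ} (hρ : 0 < ρ) (F : ℝ → ℝ → ℝ≥0∞) :
    ∫⁻ s, F (s / √(s ^ 2 + ρ ^ 2)) (√(s ^ 2 + ρ ^ 2)) =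
      ∫⁻ t in Ioo (-1 : ℝ) 1, ENNReal.ofReal (ρ * (√(1 - t ^ 2) ^ 3)⁻¹) *
        F t (ρ / √(1 - t ^ 2)) := by
  have hinv : ∀ t ∈ Ioo (-1 : ℝ) 1, (ρ * t / √(1 - t ^ 2)) /
      √((ρ * t / √(1 - t ^ 2)) ^ 2 + ρ ^ 2) = t := fun t ht => by
    rw [sqrt_sq_add_sq_of_div_sqrt hρ ht]
    have h0 : 0 < 1 - t ^ 2 := by nlinarith [ht.1, ht.2]
    have ha := Real.sqrt_pos.2 h0
    field_simp
  have himg : (fun t => ρ * t / √(1 - t ^ 2)) '' Ioo (-1 : ℝ) 1 = univ :=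
    eq_univ_of_forall fun s => ⟨_, div_sqrt_sq_add_sq_mem_Ioo hρ s,
      div_sqrt_one_sub_sq_of_div_sqrt hρ s⟩
  have hinj : InjOn (fun t => ρ * t / √(1 - t ^ 2)) (Ioo (-1 : ℝ) 1) := fun t ht u hu h => by
    dsimp only at h
    rw [← hinv t ht, ← hinv u hu, h]
  rw [← setLIntegral_univ, ← himg, lintegral_image_eq_lintegral_abs_deriv_mul measurableSet_Ioo
    (fun t ht => (hasDerivAt_div_sqrt_one_sub_sq ρ ht).hasDerivWithinAt) hinj]
  refine setLIntegral_congr_fun measurableSet_Ioo fun t ht => ?_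
  rw [hinv t ht, sqrt_sq_add_sq_of_div_sqrt hρ ht, abs_of_nonneg (by positivity)]

/-- The Euclidean norm on `Fin d → ℝ`, whose own norm is the supremum norm. -/
noncomputable def euclideanLength {d : ℕ} (w : Fin d → ℝ) : ℝ := √(∑ i, w i ^ 2)

theorem measurable_euclideanLength {d : ℕ} : Measurable (euclideanLength (d := d)) := by
  unfold euclideanLength; fun_prop

theorem euclideanLength_smul {d : ℕ} {a : ℝ} (ha : 0 ≤ a) (w : Fin d → ℝ) :
    euclideanLength (a • w) = a * euclideanLength w := by
  simp only [euclideanLength, Pi.smul_apply, smul_eq_mul, mul_pow, ← Finset.mul_sum]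
  rw [Real.sqrt_mul (by positivity), Real.sqrt_sq ha]

theorem euclideanLength_pos {d : ℕ} {w : Fin d → ℝ} (hw : w ≠ 0) : 0 < euclideanLength w := by
  obtain ⟨i, hi⟩ := Function.ne_iff.1 hw
  refine Real.sqrt_pos.2 (Finset.sum_pos' (fun _ _ => sq_nonneg _) ⟨i, Finset.mem_univ _, ?_⟩)
  exact sq_pos_of_ne_zero hi

theorem lintegral_eq_ofReal_pow_mul_lintegral_smul {d : ℕ} {a : ℝ} (ha : 0 < a)
    {F : (Fin d → ℝ) → ℝ≥0∞} (hF : Measurable F) :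
    ∫⁻ w, F w = ENNReal.ofReal (a ^ d) * ∫⁻ w, F (a • w) := by
  have h := Measure.map_addHaar_smul (volume : Measure (Fin d → ℝ)) ha.ne'
  rw [← lintegral_map (μ := volume) (f := F) (g := fun w => a • w) hF (by fun_prop), h,
    lintegral_smul_measure, Module.finrank_fin_fun, smul_eq_mul, ← mul_assoc,
    ← ENNReal.ofReal_mul (by positivity), abs_of_pos (by positivity),
    mul_inv_cancel₀ (by positivity), ENNReal.ofReal_one, one_mul]

/-- The first moment of the Euclidean length over a ball scales as the power `d + 1` of the
radius. -/
theorem lintegral_euclideanLength_ball (d : ℕ) {a : ℝ} (ha : 0 < a) :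
    ∫⁻ w : Fin d → ℝ, {w | euclideanLength w < a}.indicator
        (fun w => ENNReal.ofReal (euclideanLength w)) w =
      ENNReal.ofReal (a ^ (d + 1)) * ∫⁻ w : Fin d → ℝ, {w | euclideanLength w < 1}.indicator
        (fun w => ENNReal.ofReal (euclideanLength w)) w := by
  have hm : ∀ a : ℝ, MeasurableSet {w : Fin d → ℝ | euclideanLength w < a} := fun a =>
    measurableSet_lt measurable_euclideanLength measurable_const
  have hm1 := measurable_euclideanLength (d := d)
  rw [lintegral_eq_ofReal_pow_mul_lintegral_smul ha (hm1.ennreal_ofReal.indicator (hm a)),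
    pow_succ, ENNReal.ofReal_mul (by positivity), mul_assoc,
    ← lintegral_const_mul _ (hm1.ennreal_ofReal.indicator (hm 1))]
  congr 2
  funext w
  simp only [indicator, mem_ofPred_eq, euclideanLength_smul ha.le, mul_ite, mul_zero,
    ENNReal.ofReal_mul ha.le]
  congr 1
  rw [eq_iff_iff, mul_lt_iff_lt_one_right ha]

theorem sphereWeight_eq {d : ℕ} {t : ℝ} (ht : t ∈ Ioo (-1 : ℝ) 1) :
    sphereWeight d t = (√(1 - t ^ 2) ^ 3)⁻¹ * √(1 - t ^ 2) ^ (d + 1) := by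
  have h0 : 0 < 1 - t ^ 2 := by nlinarith [ht.1, ht.2]
  rw [sphereWeight, Real.sqrt_eq_rpow, ← Real.rpow_natCast (_ ^ (1 / 2 : ℝ)),
    ← Real.rpow_natCast (_ ^ (1 / 2 : ℝ)), ← Real.rpow_mul h0.le, ← Real.rpow_mul h0.le, ← Real.rpow_neg h0.le, ← Real.rpow_add h0]
  congr 1
  push_cast
  ring

/-- The normalizing constant of the law of a coordinate under the surface measure. -/
noncomputable def coordinateConst (d : ℕ) : ℝ≥0∞ :=
  (d + 1 : ℕ) * ∫⁻ w : Fin d → ℝ, {w | euclideanLength w < 1}.indicator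
    (fun w => ENNReal.ofReal (euclideanLength w)) w

/-- The volume of the part of the punctured unit ball of `ℝ × ℝ^d` where the normalized first
coordinate lies in `A`. -/
theorem volume_cone_prod {d : ℕ} (hd : 1 ≤ d) {A : Set ℝ} (hA : MeasurableSet A) :
    volume {p : ℝ × (Fin d → ℝ) | √(p.1 ^ 2 + euclideanLength p.2 ^ 2) ∈ Ioo (0 : ℝ) 1 ∧
      p.1 / √(p.1 ^ 2 + euclideanLength p.2 ^ 2) ∈ A} =
    (∫⁻ w : Fin d → ℝ, {w | euclideanLength w < 1}.indicator
      (fun w => ENNReal.ofReal (euclideanLength w)) w) *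
      ∫⁻ t in Ioo (-1 : ℝ) 1, A.indicator (fun t => ENNReal.ofReal (sphereWeight d t)) t := by
  have hm := measurable_euclideanLength (d := d)
  have hr : Measurable fun p : ℝ × (Fin d → ℝ) => √(p.1 ^ 2 + euclideanLength p.2 ^ 2) := by
    fun_prop
  set S := {p : ℝ × (Fin d → ℝ) | √(p.1 ^ 2 + euclideanLength p.2 ^ 2) ∈ Ioo (0 : ℝ) 1 ∧
      p.1 / √(p.1 ^ 2 + euclideanLength p.2 ^ 2) ∈ A} with hS
  have hSm : MeasurableSet S :=
    (hr measurableSet_Ioo).inter ((measurable_fst.div hr) hA)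
  -- the slice at `w`, in the variable `t = s / √(s ^ 2 + |w| ^ 2)`
  have hslice : ∀ w : Fin d → ℝ, w ≠ 0 → volume ((fun s => (s, w)) ⁻¹' S) =
      ∫⁻ t in Ioo (-1 : ℝ) 1, A.indicator (fun _ => ENNReal.ofReal (√(1 - t ^ 2) ^ 3)⁻¹ *
        {w | euclideanLength w < √(1 - t ^ 2)}.indicator
          (fun w => ENNReal.ofReal (euclideanLength w)) w) t := fun w hw => by
    have hρ := euclideanLength_pos hw
    rw [← lintegral_indicator_one (measurable_prodMk_right hSm)]
    have := lintegral_comp_div_sqrt hρ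
      fun t r => (Ioo (0 : ℝ) 1).indicator (fun _ => A.indicator 1 t) r
    refine Eq.trans (lintegral_congr fun s => ?_) (this.trans ?_)
    · by_cases h1 : √(s ^ 2 + euclideanLength w ^ 2) ∈ Ioo (0 : ℝ) 1 <;>
        by_cases h2 : s / √(s ^ 2 + euclideanLength w ^ 2) ∈ A
      · rw [indicator_of_mem (show s ∈ (fun s => (s, w)) ⁻¹' S from ⟨h1, h2⟩), indicator_of_mem h1, indicator_of_mem h2]
        rfl
      · rw [indicator_of_notMem (show s ∉ (fun s => (s, w)) ⁻¹' S from fun h => h2 h.2), indicator_of_mem h1,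
          indicator_of_notMem h2]
      · rw [indicator_of_notMem (show s ∉ (fun s => (s, w)) ⁻¹' S from fun h => h1 h.1), indicator_of_notMem h1]
      · rw [indicator_of_notMem (show s ∉ (fun s => (s, w)) ⁻¹' S from fun h => h1 h.1), indicator_of_notMem h1]
    · refine setLIntegral_congr_fun measurableSet_Ioo fun t ht => ?_
      have h0 : 0 < 1 - t ^ 2 := by nlinarith [ht.1, ht.2]
      have ha := Real.sqrt_pos.2 h0
      have hiff : euclideanLength w / √(1 - t ^ 2) ∈ Ioo (0 : ℝ) 1 ↔
          euclideanLength w < √(1 - t ^ 2) := by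
        rw [mem_Ioo, div_lt_one ha]
        exact and_iff_right (div_pos hρ ha)
      by_cases h1 : euclideanLength w < √(1 - t ^ 2) <;> by_cases h2 : t ∈ A
      · rw [indicator_of_mem (hiff.2 h1), indicator_of_mem h2, indicator_of_mem h2,
          indicator_of_mem (show w ∈ _ from h1), Pi.one_apply, mul_one, mul_comm,
          ENNReal.ofReal_mul (by positivity)]
      · rw [indicator_of_mem (hiff.2 h1), indicator_of_notMem h2, indicator_of_notMem h2, mul_zero]
      · rw [indicator_of_notMem (hiff.not.2 h1), indicator_of_mem h2,
          indicator_of_notMem (show w ∉ _ from h1), mul_zero, mul_zero]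
      · rw [indicator_of_notMem (hiff.not.2 h1), indicator_of_notMem h2, mul_zero]
  -- makes points of `Fin d → ℝ` null sets, so that `w = 0` can be discarded
  have : Nonempty (Fin d) := ⟨⟨0, hd⟩⟩
  have hball : MeasurableSet {q : (Fin d → ℝ) × ℝ | euclideanLength q.1 < √(1 - q.2 ^ 2)} :=
    measurableSet_lt (hm.comp measurable_fst) (by fun_prop)
  have hint : Measurable fun q : (Fin d → ℝ) × ℝ =>
      A.indicator (fun _ => ENNReal.ofReal (√(1 - q.2 ^ 2) ^ 3)⁻¹ *
        {w | euclideanLength w < √(1 - q.2 ^ 2)}.indicator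
          (fun w => ENNReal.ofReal (euclideanLength w)) q.1) q.2 := by
    have h1 : Measurable fun q : (Fin d → ℝ) × ℝ => ENNReal.ofReal (√(1 - q.2 ^ 2) ^ 3)⁻¹ := by
      fun_prop
    have h2 := ((hm.comp measurable_fst).ennreal_ofReal).indicator hball
    exact (h1.mul h2).indicator (measurable_snd hA)
  rw [Measure.volume_eq_prod, Measure.prod_apply_symm hSm,
    lintegral_congr_ae ((ae_iff.2 (by simp)).mono hslice :
      (fun w => volume ((fun s => (s, w)) ⁻¹' S)) =ᵐ[volume] _),
    lintegral_lintegral_swap hint.aemeasurable,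
    ← lintegral_const_mul]
  · refine setLIntegral_congr_fun measurableSet_Ioo fun t ht => ?_
    have h0 : 0 < 1 - t ^ 2 := by nlinarith [ht.1, ht.2]
    have ha := Real.sqrt_pos.2 h0
    by_cases h2 : t ∈ A
    · simp only [indicator_of_mem h2]
      rw [lintegral_const_mul' _ _ ENNReal.ofReal_ne_top, lintegral_euclideanLength_ball d ha,
        sphereWeight_eq ht, ENNReal.ofReal_mul (by positivity), ← mul_assoc, mul_comm]
    · simp only [indicator_of_notMem h2, lintegral_zero, mul_zero]
  · unfold sphereWeight
    exact Measurable.indicator (by fun_prop) hA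

theorem norm_eq_sqrt_sq_add_euclideanLength_sq {d : ℕ} (z : EuclideanSpace ℝ (Fin (d + 1))) :
    ‖z‖ = √(z 0 ^ 2 + euclideanLength (fun i => z (Fin.succ i)) ^ 2) := by
  rw [EuclideanSpace.norm_eq, Fin.sum_univ_succ, euclideanLength,
    Real.sq_sqrt (Finset.sum_nonneg fun _ _ => sq_nonneg _)]
  simp

/-- The volume of the part of the punctured unit ball where the cosine of the angle with `x` lies in
`A`. A reflection carries `x` to the first basis vector, so the volume does not depend on `x`. -/
theorem volume_cone {d : ℕ} (hd : 1 ≤ d) (x : UnitSphere d) {A : Set ℝ} (hA : MeasurableSet A) :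
    volume {z : EuclideanSpace ℝ (Fin (d + 1)) | ‖z‖ ∈ Ioo (0 : ℝ) 1 ∧
      inner ℝ (x : EuclideanSpace ℝ (Fin (d + 1))) z / ‖z‖ ∈ A} =
    (∫⁻ w : Fin d → ℝ, {w | euclideanLength w < 1}.indicator
      (fun w => ENNReal.ofReal (euclideanLength w)) w) *
      ∫⁻ t in Ioo (-1 : ℝ) 1, A.indicator (fun t => ENNReal.ofReal (sphereWeight d t)) t := by
  rw [← volume_cone_prod hd hA]
  set e₀ : EuclideanSpace ℝ (Fin (d + 1)) := EuclideanSpace.single 0 1 with he₀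
  have hnorm : ‖(x : EuclideanSpace ℝ (Fin (d + 1)))‖ = ‖e₀‖ := by
    rw [he₀, PiLp.norm_single, norm_one, mem_sphere_zero_iff_norm.1 x.2]
  set R := (ℝ ∙ ((x : EuclideanSpace ℝ (Fin (d + 1))) - e₀))ᗮ.reflection
  have hRx : R x = e₀ := Submodule.reflection_sub hnorm
  set S' : Set (EuclideanSpace ℝ (Fin (d + 1))) := {z | ‖z‖ ∈ Ioo (0 : ℝ) 1 ∧ z 0 / ‖z‖ ∈ A}
  have hS' : MeasurableSet S' :=
    (measurable_norm measurableSet_Ioo).inter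
      (((by fun_prop : Measurable fun z : EuclideanSpace ℝ (Fin (d + 1)) => z 0).div
        measurable_norm) hA)
  have h1 : {z : EuclideanSpace ℝ (Fin (d + 1)) | ‖z‖ ∈ Ioo (0 : ℝ) 1 ∧
      inner ℝ (x : EuclideanSpace ℝ (Fin (d + 1))) z / ‖z‖ ∈ A} = R ⁻¹' S' := by
    ext z
    have hin : inner ℝ (x : EuclideanSpace ℝ (Fin (d + 1))) z = R z 0 := by
      rw [← R.inner_map_map, hRx, he₀, EuclideanSpace.inner_single_left]
      simp
    simp only [mem_ofPred_eq, mem_preimage, S', hin, R.norm_map]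
  rw [h1, R.measurePreserving.measure_preimage hS'.nullMeasurableSet]
  have hp := (volume_preserving_piFinSuccAbove (fun _ : Fin (d + 1) => ℝ) 0).comp
    (PiLp.volume_preserving_ofLp (Fin (d + 1)))
  rw [← hp.measure_preimage]
  · congr 1
    ext z
    simp only [S', mem_ofPred_eq, mem_preimage, norm_eq_sqrt_sq_add_euclideanLength_sq z]
    rfl
  · have hm := measurable_euclideanLength (d := d)
    have hr : Measurable fun p : ℝ × (Fin d → ℝ) => √(p.1 ^ 2 + euclideanLength p.2 ^ 2) := by
      fun_prop
    exact ((hr measurableSet_Ioo).inter ((measurable_fst.div hr) hA)).nullMeasurableSet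

theorem continuous_sphereInner {d : ℕ} :
    Continuous fun p : UnitSphere d × UnitSphere d => sphereInner p.1 p.2 := by
  unfold sphereInner; fun_prop

theorem continuous_sphereInner_right {d : ℕ} (x : UnitSphere d) :
    Continuous fun y : UnitSphere d => sphereInner x y :=
  continuous_sphereInner.comp (Continuous.prodMk_right x)

open scoped Pointwise in
/-- Archimedes' theorem: under the surface measure of the sphere, the coordinate in a given
direction has density proportional to the weight `(1 - t ^ 2) ^ (d / 2 - 1)`. -/
theorem map_sphereInner_surfaceMeasure {d : ℕ} (hd : 1 ≤ d) (x : UnitSphere d) :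
    (surfaceMeasure d).map (fun y => sphereInner x y) =
      coordinateConst d • (volume.restrict (Ioo (-1 : ℝ) 1)).withDensity
        (fun t => ENNReal.ofReal (sphereWeight d t)) := by
  have hmeas := (continuous_sphereInner_right x).measurable
  refine Measure.ext fun A hA => ?_
  have hcone : Ioo (0 : ℝ) 1 • ((↑) '' ((fun y => sphereInner x y) ⁻¹' A) :
      Set (EuclideanSpace ℝ (Fin (d + 1)))) =
      {z | ‖z‖ ∈ Ioo (0 : ℝ) 1 ∧ inner ℝ (x : EuclideanSpace ℝ (Fin (d + 1))) z / ‖z‖ ∈ A} := by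
    ext z
    rw [Set.mem_smul]
    constructor
    · rintro ⟨r, hr, _, ⟨y, hy, rfl⟩, rfl⟩
      have hn : ‖r • (y : EuclideanSpace ℝ (Fin (d + 1)))‖ = r := by
        rw [norm_smul, mem_sphere_zero_iff_norm.1 y.2, mul_one, Real.norm_of_nonneg hr.1.le]
      rw [mem_ofPred_eq, hn, inner_smul_right, mul_div_cancel_left₀ _ hr.1.ne']
      exact ⟨hr, hy⟩
    · rintro ⟨hr, hz⟩
      refine ⟨‖z‖, hr, ‖z‖⁻¹ • z, ⟨⟨‖z‖⁻¹ • z, ?_⟩, ?_, rfl⟩, ?_⟩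
      · rw [mem_sphere_zero_iff_norm, norm_smul, norm_inv, norm_norm, inv_mul_cancel₀ hr.1.ne']
      · rw [mem_preimage, sphereInner, inner_smul_right, inv_mul_eq_div]
        exact hz
      · rw [smul_smul, mul_inv_cancel₀ hr.1.ne', one_smul]
  rw [Measure.map_apply hmeas hA, surfaceMeasure, Measure.toSphere_apply' _ (hmeas hA), hcone,
    volume_cone hd x hA, finrank_euclideanSpace_fin, Measure.smul_apply, withDensity_apply _ hA,
    smul_eq_mul, coordinateConst, mul_assoc, Measure.restrict_restrict hA,
    lintegral_indicator hA, Measure.restrict_restrict hA]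

instance {d : ℕ} : IsFiniteMeasure (surfaceMeasure d) := by
  unfold surfaceMeasure; infer_instance

theorem sphereArea_pos (d : ℕ) : 0 < sphereArea d := by
  refine ENNReal.toReal_pos (Measure.measure_univ_ne_zero.2 ?_) (measure_ne_top _ _)
  exact Measure.toSphere_ne_zero _

instance {d : ℕ} : Nonempty (UnitSphere d) :=
  ⟨⟨EuclideanSpace.single 0 1, by simp⟩⟩

theorem measurable_sphereWeight (d : ℕ) : Measurable (sphereWeight d) := by
  unfold sphereWeight; fun_prop

theorem coordinateConst_mul_lintegral {d : ℕ} (hd : 1 ≤ d) :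
    coordinateConst d * ∫⁻ t in Ioo (-1 : ℝ) 1, ENNReal.ofReal (sphereWeight d t) =
      surfaceMeasure d univ := by
  have x : UnitSphere d := Classical.arbitrary _
  have h := congrArg (fun μ => μ univ) (map_sphereInner_surfaceMeasure hd x)
  rw [Measure.map_apply (continuous_sphereInner_right x).measurable .univ, preimage_univ] at h
  rw [h, Measure.smul_apply, withDensity_apply _ .univ, Measure.restrict_univ, smul_eq_mul]

theorem sphereWeight_pos {d : ℕ} {t : ℝ} (ht : t ∈ Ioo (-1 : ℝ) 1) : 0 < sphereWeight d t :=
  Real.rpow_pos_of_pos (by nlinarith [ht.1, ht.2]) _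

theorem coordinateConst_ne_zero {d : ℕ} (hd : 1 ≤ d) : coordinateConst d ≠ 0 := by
  intro h
  have h1 := coordinateConst_mul_lintegral hd
  rw [h, zero_mul] at h1
  have h2 := sphereArea_pos d
  rw [sphereArea, measureReal_def, ← h1] at h2
  simp at h2

theorem integrableOn_sphereWeight {d : ℕ} (hd : 1 ≤ d) :
    IntegrableOn (sphereWeight d) (Ioo (-1 : ℝ) 1) := by
  have h1 := coordinateConst_mul_lintegral hd
  have h2 : ∫⁻ t in Ioo (-1 : ℝ) 1, ENNReal.ofReal (sphereWeight d t) ≠ ∞ := by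
    intro h
    rw [h, ENNReal.mul_top (coordinateConst_ne_zero hd)] at h1
    exact measure_ne_top (surfaceMeasure d) univ h1.symm
  refine ⟨(measurable_sphereWeight d).aestronglyMeasurable, ?_⟩
  rw [hasFiniteIntegral_iff_ofReal]
  · exact h2.lt_top
  · exact (ae_restrict_mem measurableSet_Ioo).mono fun t ht => (sphereWeight_pos ht).le

theorem integral_comp_sphereInner_eq {d : ℕ} (hd : 1 ≤ d) (x : UnitSphere d) {f : ℝ → ℝ}
    (hf : AEStronglyMeasurable f ((surfaceMeasure d).map fun y => sphereInner x y)) :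
    ∫ y, f (sphereInner x y) ∂(surfaceMeasure d) =
      (coordinateConst d).toReal * ∫ t in (-1 : ℝ)..1, f t * sphereWeight d t := by
  rw [← integral_map (continuous_sphereInner_right x).measurable.aemeasurable hf,
    map_sphereInner_surfaceMeasure hd x, integral_smul_measure, smul_eq_mul,
    intervalIntegral.integral_of_le (by norm_num), integral_Ioc_eq_integral_Ioo,
    integral_withDensity_eq_integral_toReal_smul (measurable_sphereWeight d).ennreal_ofReal
      (by simp)]
  congr 1
  refine setIntegral_congr_fun measurableSet_Ioo fun t ht => ?_
  rw [ENNReal.toReal_ofReal (sphereWeight_pos ht).le, smul_eq_mul, mul_comm]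

/-- The spherical average of a zonal function is its weighted average over `[-1, 1]`. -/
theorem integral_comp_sphereInner {d : ℕ} (hd : 1 ≤ d) (x : UnitSphere d) {f : ℝ → ℝ}
    (hf : ContinuousOn f (Icc (-1) 1)) :
    ∫ y, f (sphereInner x y) ∂(surfaceMeasure d) = sphereArea d * weightedAverage d f := by
  have h1 := integral_comp_sphereInner_eq hd x (f := fun _ => 1) aestronglyMeasurable_const
  have hfm : AEStronglyMeasurable f ((surfaceMeasure d).map fun y => sphereInner x y) := by
    rw [map_sphereInner_surfaceMeasure hd x]
    refine AEStronglyMeasurable.smul_measure ?_ _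
    exact ((hf.mono Ioo_subset_Icc_self).aestronglyMeasurable measurableSet_Ioo).mono_ac
      (withDensity_absolutelyContinuous _ _)
  rw [integral_comp_sphereInner_eq hd x hfm, weightedAverage]
  simp only [integral_const, smul_eq_mul, mul_one, one_mul] at h1
  have hpos := sphereArea_pos d
  rw [sphereArea] at hpos ⊢
  rw [h1] at hpos ⊢
  have hne : (∫ t in (-1 : ℝ)..1, sphereWeight d t) ≠ 0 := fun h => by simp [h] at hpos
  field_simp

/-! ### The covariance kernel and its iterates -/

theorem pow_mem_Icc_neg_one_one {t : ℝ} (ht : t ∈ Icc (-1 : ℝ) 1) (q : ℕ) :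
    t ^ q ∈ Icc (-1 : ℝ) 1 := by
  have h : |t ^ q| ≤ 1 := by
    rw [abs_pow]
    exact pow_le_one₀ (abs_nonneg t) (abs_le.2 ht)
  exact abs_le.1 h

theorem one_sub_pow_le {t : ℝ} (ht : t ∈ Icc (-1 : ℝ) 1) (q : ℕ) : 1 - t ^ q ≤ q * (1 - t) := by
  have := one_add_mul_le_pow (a := t - 1) (by linarith [ht.1]) q
  rw [add_sub_cancel] at this
  linarith

theorem one_sub_pow_lt {t : ℝ} (ht : t ∈ Ico (-1 : ℝ) 1) {q : ℕ} (hq : 2 ≤ q) :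
    1 - t ^ q < q * (1 - t) := by
  obtain ⟨q, rfl⟩ := Nat.exists_eq_add_of_le' hq
  have h1 := one_sub_pow_le ⟨ht.1, ht.2.le⟩ q
  push_cast
  have h2 : 1 - t ^ (q + 2) = (1 - t ^ q) + t ^ q * ((1 - t) * (1 + t)) := by ring
  have h3 := (pow_mem_Icc_neg_one_one ⟨ht.1, ht.2.le⟩ q).2
  have h4 : t ^ q * ((1 - t) * (1 + t)) ≤ 1 * ((1 - t) * (1 + t)) :=
    mul_le_mul_of_nonneg_right h3 (mul_nonneg (by linarith [ht.2]) (by linarith [ht.1]))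
  have h5 : (1 - t) * (1 + t) < (1 - t) * 2 :=
    mul_lt_mul_of_pos_left (by linarith [ht.2]) (by linarith [ht.2])
  linarith

namespace IsCovarianceKernel

variable {κ : ℝ → ℝ} {J : ℕ → ℝ}

theorem coeff_nonneg (J : ℕ → ℝ) (q : ℕ) : 0 ≤ J q ^ 2 / (q ! : ℝ) := by positivity

theorem hasSum_coeff (hκ : IsCovarianceKernel κ J) :
    HasSum (fun q : ℕ => J q ^ 2 / (q ! : ℝ)) 1 := by
  simpa [hκ.map_one] using hκ.hasSum 1 (by simp)

theorem mapsTo (hκ : IsCovarianceKernel κ J) : MapsTo κ (Icc (-1) 1) (Icc (-1) 1) := by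
  intro t ht
  have h := hκ.hasSum t ht
  constructor
  · refine hasSum_le (fun q => ?_) hκ.hasSum_coeff.neg h
    nlinarith [coeff_nonneg J q, (pow_mem_Icc_neg_one_one ht q).1]
  · refine hasSum_le (fun q => ?_) h hκ.hasSum_coeff
    exact mul_le_of_le_one_right (coeff_nonneg J q) (pow_mem_Icc_neg_one_one ht q).2

theorem monotoneOn (hκ : IsCovarianceKernel κ J) : MonotoneOn κ (Icc 0 1) := by
  intro s hs t ht hst
  refine hasSum_le (fun q => ?_) (hκ.hasSum s ⟨by linarith [hs.1], hs.2⟩)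
    (hκ.hasSum t ⟨by linarith [ht.1], ht.2⟩)
  exact mul_le_mul_of_nonneg_left (pow_le_pow_left₀ hs.1 hst q) (coeff_nonneg J q)

theorem mapsTo_nonneg (hκ : IsCovarianceKernel κ J) : MapsTo κ (Icc 0 1) (Icc 0 1) := by
  intro t ht
  have ht' : t ∈ Icc (-1 : ℝ) 1 := ⟨by linarith [ht.1], ht.2⟩
  exact ⟨hasSum_le (fun q => mul_nonneg (coeff_nonneg J q) (pow_nonneg ht.1 q)) hasSum_zero
    (hκ.hasSum t ht'), (hκ.mapsTo ht').2⟩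

theorem hasSum_one_sub (hκ : IsCovarianceKernel κ J) {t : ℝ} (ht : t ∈ Icc (-1 : ℝ) 1) :
    HasSum (fun q : ℕ => J q ^ 2 / (q ! : ℝ) * (1 - t ^ q)) (1 - κ t) := by
  simpa only [mul_sub, mul_one] using hκ.hasSum_coeff.sub (hκ.hasSum t ht)

theorem tendsto_slope (hκ : IsCovarianceKernel κ J) :
    Tendsto (fun s => (1 - κ s) / (1 - s)) (𝓝[<] 1) (𝓝 (derivAtOne κ)) := by
  have hd : HasDerivWithinAt κ (derivAtOne κ) (Icc (-1) 1) 1 :=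
    ((hκ.contDiffOn.differentiableOn one_ne_zero) 1 (by simp)).hasDerivWithinAt
  rw [hasDerivWithinAt_iff_tendsto_slope] at hd
  have hle : 𝓝[<] (1 : ℝ) ≤ 𝓝[Icc (-1) 1 \ {1}] 1 := by
    rw [nhdsWithin_le_iff]
    filter_upwards [Ioo_mem_nhdsLT (show (-1 : ℝ) < 1 by norm_num)] with s hs
    exact ⟨⟨hs.1.le, hs.2.le⟩, hs.2.ne⟩
  refine (hd.mono_left hle).congr fun s => ?_
  rw [slope_def_field, hκ.map_one, ← neg_div_neg_eq, neg_sub, neg_sub]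

/-- The differentiated power series, evaluated at `1`, is dominated by the one-sided derivative: the
difference quotients of `κ` at `1` dominate those of each partial sum. -/
theorem sum_coeff_mul_le (hκ : IsCovarianceKernel κ J) (n : ℕ) :
    ∑ q ∈ Finset.range n, J q ^ 2 / (q ! : ℝ) * q ≤ derivAtOne κ := by
  have hlim : Tendsto (fun s : ℝ => ∑ q ∈ Finset.range n,
      J q ^ 2 / (q ! : ℝ) * ∑ i ∈ Finset.range q, s ^ i) (𝓝[<] 1)
      (𝓝 (∑ q ∈ Finset.range n, J q ^ 2 / (q ! : ℝ) * q)) := by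
    have hc : Continuous fun s : ℝ => ∑ q ∈ Finset.range n,
      J q ^ 2 / (q ! : ℝ) * ∑ i ∈ Finset.range q, s ^ i := by fun_prop
    simpa using (hc.tendsto 1).mono_left nhdsWithin_le_nhds
  refine le_of_tendsto_of_tendsto hlim hκ.tendsto_slope ?_
  filter_upwards [Ioo_mem_nhdsLT (show (-1 : ℝ) < 1 by norm_num)] with s hs
  have hs' : s ∈ Icc (-1 : ℝ) 1 := ⟨hs.1.le, hs.2.le⟩
  rw [le_div_iff₀ (by linarith [hs.2]), Finset.sum_mul]
  refine le_trans (le_of_eq (Finset.sum_congr rfl fun q _ => ?_))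
    (sum_le_hasSum (Finset.range n) (fun q _ => mul_nonneg (coeff_nonneg J q)
      (sub_nonneg.2 (pow_mem_Icc_neg_one_one hs' q).2)) (hκ.hasSum_one_sub hs'))
  rw [mul_assoc, geom_sum_mul_neg]

theorem exists_hasSum_coeff_mul (hκ : IsCovarianceKernel κ J) :
    ∃ M ≤ derivAtOne κ, HasSum (fun q : ℕ => J q ^ 2 / (q ! : ℝ) * q) M := by
  have h0 : ∀ q : ℕ, 0 ≤ J q ^ 2 / (q ! : ℝ) * q := fun q =>
    mul_nonneg (coeff_nonneg J q) q.cast_nonneg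
  have hs := summable_of_sum_range_le h0 hκ.sum_coeff_mul_le
  exact ⟨_, hs.tsum_le_of_sum_range_le hκ.sum_coeff_mul_le, hs.hasSum⟩

/-- Strictness comes from a nonzero coefficient of degree at least two. -/
theorem one_sub_lt (hκ : IsCovarianceKernel κ J) {t : ℝ} (ht : t ∈ Ico (-1 : ℝ) 1) :
    1 - κ t < derivAtOne κ * (1 - t) := by
  have ht' : t ∈ Icc (-1 : ℝ) 1 := ⟨ht.1, ht.2.le⟩
  obtain ⟨M, hM, hs⟩ := hκ.exists_hasSum_coeff_mul
  obtain ⟨q, hq, hq1⟩ := hκ.infinite.exists_gt 1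
  have hpos : 0 < J q ^ 2 / (q ! : ℝ) := by
    have : J q ≠ 0 := hq
    positivity
  refine lt_of_lt_of_le (hasSum_lt (i := q) (fun q => ?_) ?_ (hκ.hasSum_one_sub ht')
    (hs.mul_right (1 - t))) (mul_le_mul_of_nonneg_right hM (by linarith [ht.2]))
  · rw [mul_assoc]
    exact mul_le_mul_of_nonneg_left (one_sub_pow_le ht' q) (coeff_nonneg J q)
  · rw [mul_assoc]
    exact mul_lt_mul_of_pos_left (one_sub_pow_lt ht hq1) hpos

theorem one_sub_le (hκ : IsCovarianceKernel κ J) {t : ℝ} (ht : t ∈ Icc (-1 : ℝ) 1) :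
    1 - κ t ≤ derivAtOne κ * (1 - t) := by
  rcases ht.2.lt_or_eq with h | rfl
  · exact (hκ.one_sub_lt ⟨ht.1, h⟩).le
  · simp [hκ.map_one]

theorem derivAtOne_pos (hκ : IsCovarianceKernel κ J) : 0 < derivAtOne κ := by
  have h := hκ.one_sub_lt (t := -1) (by norm_num)
  have := (hκ.mapsTo (x := -1) (by norm_num)).2
  linarith

theorem iterate_mem (hκ : IsCovarianceKernel κ J) {t : ℝ} (ht : t ∈ Icc (-1 : ℝ) 1) (L : ℕ) :
    κ^[L] t ∈ Icc (-1 : ℝ) 1 :=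
  hκ.mapsTo.iterate L ht

theorem continuousOn_iterate (hκ : IsCovarianceKernel κ J) (L : ℕ) :
    ContinuousOn κ^[L] (Icc (-1) 1) :=
  hκ.contDiffOn.continuousOn.iterate hκ.mapsTo L

theorem iterate_one (hκ : IsCovarianceKernel κ J) (L : ℕ) : κ^[L] 1 = 1 :=
  Function.iterate_fixed hκ.map_one L

theorem one_sub_iterate_nonneg (hκ : IsCovarianceKernel κ J) {t : ℝ} (ht : t ∈ Icc (-1 : ℝ) 1)
    (L : ℕ) : 0 ≤ 1 - κ^[L] t :=
  sub_nonneg.2 (hκ.iterate_mem ht L).2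

/-! ### Geometric rate: the low-disorder regime -/

theorem antitone_low_disorder (hκ : IsCovarianceKernel κ J) {t : ℝ} (ht : t ∈ Icc (-1 : ℝ) 1) :
    Antitone fun L : ℕ => (derivAtOne κ ^ L)⁻¹ * (1 - κ^[L] t) := by
  have hpos := hκ.derivAtOne_pos
  refine antitone_nat_of_succ_le fun L => ?_
  rw [Function.iterate_succ_apply', pow_succ, mul_inv, mul_assoc]
  refine mul_le_mul_of_nonneg_left ?_ (by positivity)
  rw [inv_mul_le_iff₀ hpos]
  exact hκ.one_sub_le (hκ.iterate_mem ht L)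

theorem tendsto_low_disorder (hκ : IsCovarianceKernel κ J) {t : ℝ} (ht : t ∈ Icc (-1 : ℝ) 1) :
    ∃ l, Tendsto (fun L : ℕ => (derivAtOne κ ^ L)⁻¹ * (1 - κ^[L] t)) atTop (𝓝 l) := by
  refine ⟨_, tendsto_atTop_ciInf (hκ.antitone_low_disorder ht) ⟨0, ?_⟩⟩
  rintro _ ⟨L, rfl⟩
  exact mul_nonneg (inv_nonneg.2 (pow_nonneg hκ.derivAtOne_pos.le L))
    (hκ.one_sub_iterate_nonneg ht L)

theorem low_disorder_le (hκ : IsCovarianceKernel κ J) {t : ℝ} (ht : t ∈ Icc (-1 : ℝ) 1) (L : ℕ) :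
    (derivAtOne κ ^ L)⁻¹ * (1 - κ^[L] t) ≤ 2 := by
  have := hκ.antitone_low_disorder ht (Nat.zero_le L)
  simp only [pow_zero, inv_one, one_mul, Function.iterate_zero, id] at this
  linarith [ht.1]

end IsCovarianceKernel

/-! ### Polynomial rate: the sparse regime -/

/-- A positive null sequence with `u (n + 1) = u n - c u n ^ (1 + p) + o(u n ^ (1 + p))` satisfies
`n ^ (1 / p) * u n → (c p) ^ (-1 / p)`: the increments of `u ^ (-p)` tend to `c p`, and one takes
Cesàro means. -/
theorem tendsto_rpow_mul_of_recursion {u : ℕ → ℝ} {c p : ℝ} (hp : 0 < p) (hc : c ≠ 0)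
    (hu : ∀ n, 0 < u n) (hlt : ∀ n, u (n + 1) < u n) (h0 : Tendsto u atTop (𝓝 0))
    (hrec : Tendsto (fun n => (u n - u (n + 1)) / u n ^ (1 + p)) atTop (𝓝 c)) :
    Tendsto (fun n : ℕ => (n : ℝ) ^ (1 / p) * u n) atTop (𝓝 ((p * c) ^ (-(1 / p)))) := by
  have hcpos : 0 < c := lt_of_le_of_ne
    (ge_of_tendsto' hrec fun n => div_nonneg (sub_nonneg.2 (hlt n).le)
      (Real.rpow_nonneg (hu n).le _)) hc.symm
  set x : ℕ → ℝ := fun n => 1 - u (n + 1) / u n with hx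
  have hxpos : ∀ n, 0 < x n := fun n => sub_pos.2 ((div_lt_one (hu n)).2 (hlt n))
  have hxu : ∀ n, x n / u n ^ p = (u n - u (n + 1)) / u n ^ (1 + p) := fun n => by
    have := hu n
    have h1 := Real.rpow_pos_of_pos this p
    rw [Real.rpow_add this, Real.rpow_one, hx]
    field_simp
  have hx0 : Tendsto x atTop (𝓝[≠] 0) := by
    refine tendsto_nhdsWithin_iff.2 ⟨?_, Eventually.of_forall fun n => (hxpos n).ne'⟩
    have h1 : Tendsto (fun n => u n ^ p) atTop (𝓝 0) := by
      simpa [hp.ne'] using h0.rpow_const (Or.inr hp.le) (p := p)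
    have h2 := hrec.mul h1
    rw [mul_zero] at h2
    refine h2.congr fun n => ?_
    rw [← hxu, div_mul_cancel₀ _ (Real.rpow_pos_of_pos (hu n) p).ne']
  have hderiv : HasDerivAt (fun y : ℝ => (1 - y) ^ (-p)) p 0 := by
    have h1 : HasDerivAt (fun y : ℝ => 1 - y) (-1) 0 := by
      simpa using (hasDerivAt_id (0 : ℝ)).const_sub 1
    simpa using h1.rpow_const (p := -p) (Or.inl (by norm_num))
  have hslope := (hasDerivAt_iff_tendsto_slope_zero.1 hderiv).comp hx0
  have hincr : Tendsto (fun n => u (n + 1) ^ (-p) - u n ^ (-p)) atTop (𝓝 (p * c)) := by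
    refine (hslope.mul hrec).congr fun n => ?_
    have h1 := hxpos n
    have h2 : u (n + 1) = u n * (1 - x n) := by
      have := (hu n).ne'
      simp only [hx]
      field_simp
      ring
    have h3 : 0 < 1 - x n := by
      have := div_pos (hu (n + 1)) (hu n)
      simpa [hx] using this
    rw [h2, Real.mul_rpow (hu n).le h3.le, ← h2, ← hxu, Real.rpow_neg (hu n).le]
    have h4 := Real.rpow_pos_of_pos (hu n) p
    simp only [Function.comp_apply, zero_add, sub_zero, Real.one_rpow, smul_eq_mul]
    field_simp
  have hces := hincr.cesaro
  simp only [Finset.sum_range_sub (fun n => u n ^ (-p))] at hces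
  have hinv : Tendsto (fun n : ℕ => (n : ℝ)⁻¹ * u n ^ (-p)) atTop (𝓝 (p * c)) := by
    have h1 : Tendsto (fun n : ℕ => (n : ℝ)⁻¹ * u 0 ^ (-p)) atTop (𝓝 0) := by
      simpa using (tendsto_inv_atTop_nhds_zero_nat (𝕜 := ℝ)).mul_const (u 0 ^ (-p))
    have h2 := hces.add h1
    rw [add_zero] at h2
    exact h2.congr fun n => by ring
  have hfin := hinv.rpow_const (p := -(1 / p)) (Or.inl (mul_pos hp hcpos).ne')
  refine hfin.congr fun n => ?_
  rw [Real.mul_rpow (by positivity) (Real.rpow_nonneg (hu n).le _), ← Real.rpow_mul (hu n).le,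
    Real.inv_rpow (by positivity), Real.rpow_neg (by positivity), inv_inv]
  congr 1
  rw [neg_mul_neg, mul_one_div_cancel hp.ne', Real.rpow_one]

namespace IsCovarianceKernel

variable {κ : ℝ → ℝ} {J : ℕ → ℝ}

theorem lt_apply (hκ : IsCovarianceKernel κ J) (h1 : derivAtOne κ = 1) {t : ℝ}
    (ht : t ∈ Ico (-1 : ℝ) 1) : t < κ t := by
  have := hκ.one_sub_lt ht
  rw [h1] at this
  linarith

theorem tendsto_iterate (hκ : IsCovarianceKernel κ J) (h1 : derivAtOne κ = 1) {t : ℝ}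
    (ht : t ∈ Icc (-1 : ℝ) 1) : Tendsto (fun L => κ^[L] t) atTop (𝓝 1) := by
  have hmono : Monotone fun L => κ^[L] t := monotone_nat_of_le_succ fun L => by
    rw [Function.iterate_succ_apply']
    have := hκ.one_sub_le (hκ.iterate_mem ht L)
    rw [h1] at this
    linarith
  have hlim := tendsto_atTop_ciSup hmono ⟨1, by
    rintro _ ⟨L, rfl⟩
    exact (hκ.iterate_mem ht L).2⟩
  set s := ⨆ L, κ^[L] t
  have hs : s ∈ Icc (-1 : ℝ) 1 :=
    isClosed_Icc.mem_of_tendsto hlim (Eventually.of_forall (hκ.iterate_mem ht))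
  have h2 : Tendsto (fun L => κ (κ^[L] t)) atTop (𝓝 (κ s)) :=
    (hκ.contDiffOn.continuousOn s hs).tendsto.comp
      (tendsto_nhdsWithin_iff.2 ⟨hlim, Eventually.of_forall (hκ.iterate_mem ht)⟩)
  have h3 : Tendsto (fun L => κ (κ^[L] t)) atTop (𝓝 s) :=
    (hlim.comp (tendsto_add_atTop_nat 1)).congr fun L => Function.iterate_succ_apply' κ L t
  have hfix := tendsto_nhds_unique h2 h3
  rcases hs.2.lt_or_eq with h | h
  · exact absurd hfix (hκ.lt_apply h1 ⟨hs.1, h⟩).ne'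
  · rwa [h] at hlim

theorem tendsto_sparse (hκ : IsCovarianceKernel κ J) (h1 : derivAtOne κ = 1) {c ρ : ℝ}
    (hreg : CovarianceRegularity κ c ρ) {t : ℝ} (ht : t ∈ Icc (-1 : ℝ) 1) :
    ∃ l, Tendsto (fun L : ℕ => (L : ℝ) ^ (1 / (ρ - 1)) * (1 - κ^[L] t)) atTop (𝓝 l) := by
  by_cases hex : ∃ N, κ^[N] t = 1
  · -- the orbit reaches the fixed point, as it does from `-1` when the kernel is even
    obtain ⟨N, hN⟩ := hex
    refine ⟨0, tendsto_const_nhds.congr' ?_⟩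
    filter_upwards [eventually_ge_atTop N] with L hL
    obtain ⟨k, rfl⟩ := Nat.exists_eq_add_of_le' hL
    rw [Function.iterate_add_apply, hN, hκ.iterate_one, sub_self, mul_zero]
  · push Not at hex
    have hlt1 : ∀ L, κ^[L] t < 1 := fun L => lt_of_le_of_ne (hκ.iterate_mem ht L).2 (hex L)
    have hlim := hκ.tendsto_iterate h1 ht
    refine ⟨_, tendsto_rpow_mul_of_recursion (u := fun L => 1 - κ^[L] t) (c := c) (p := ρ - 1)
      (by linarith [hreg.one_lt]) hreg.c_ne_zero (fun L => sub_pos.2 (hlt1 L)) (fun L => ?_) ?_ ?_⟩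
    · rw [Function.iterate_succ_apply']
      linarith [hκ.lt_apply h1 ⟨(hκ.iterate_mem ht L).1, hlt1 L⟩]
    · simpa using hlim.const_sub 1
    · have h2 := hreg.isLittleO.tendsto_div_nhds_zero.comp
        (tendsto_nhdsWithin_iff.2 ⟨hlim, Eventually.of_forall hlt1⟩)
      have h3 := h2.const_sub c
      rw [sub_zero] at h3
      refine h3.congr fun L => ?_
      have hpos := Real.rpow_pos_of_pos (sub_pos.2 (hlt1 L)) ρ
      rw [Function.comp_apply, h1, add_sub_cancel, Function.iterate_succ_apply']
      field_simp
      ring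

theorem iterate_nonneg_of_nonneg (hκ : IsCovarianceKernel κ J) {t : ℝ} (ht : t ∈ Icc (0 : ℝ) 1)
    (L : ℕ) : κ^[L] t ∈ Icc (0 : ℝ) 1 :=
  hκ.mapsTo_nonneg.iterate L ht

/-- In the sparse regime all orbits enter `[0, 1]` after a common number of steps. -/
theorem exists_iterate_nonneg (hκ : IsCovarianceKernel κ J) (h1 : derivAtOne κ = 1) :
    ∃ N : ℕ, ∀ t ∈ Icc (-1 : ℝ) 1, κ^[N] t ∈ Icc (0 : ℝ) 1 := by
  obtain ⟨δ, hδ, hδκ⟩ : ∃ δ > 0, ∀ s ∈ Icc (-1 : ℝ) 0, s + δ ≤ κ s := by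
    have hc : ContinuousOn (fun s => κ s - s) (Icc (-1) 0) :=
      (hκ.contDiffOn.continuousOn.mono (Icc_subset_Icc_right zero_le_one)).sub continuousOn_id
    obtain ⟨s₀, hs₀, hmin⟩ := isCompact_Icc.exists_isMinOn ⟨0, by simp⟩ hc
    refine ⟨κ s₀ - s₀, sub_pos.2 (hκ.lt_apply h1 ⟨hs₀.1, by linarith [hs₀.2]⟩), fun s hs => ?_⟩
    have := isMinOn_iff.1 hmin s hs
    linarith
  obtain ⟨N, hN⟩ := exists_nat_ge (1 / δ)
  rw [div_le_iff₀ hδ] at hN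
  refine ⟨N, fun t ht => ?_⟩
  have key : ∀ n : ℕ, 0 ≤ κ^[n] t ∨ -1 + n * δ ≤ κ^[n] t := by
    intro n
    induction n with
    | zero => right; simpa using ht.1
    | succ n ih =>
      rw [Function.iterate_succ_apply']
      have hmem := hκ.iterate_mem ht n
      rcases le_or_gt 0 (κ^[n] t) with h | h
      · exact Or.inl (hκ.mapsTo_nonneg ⟨h, hmem.2⟩).1
      · right
        have h2 := hδκ _ ⟨hmem.1, h.le⟩
        have h3 := ih.resolve_left (not_le.2 h)
        push_cast
        linarith
  refine ⟨?_, (hκ.iterate_mem ht N).2⟩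
  rcases key N with h | h
  · exact h
  · linarith

theorem iterate_le_iterate (hκ : IsCovarianceKernel κ J) {s t : ℝ} (hs : s ∈ Icc (0 : ℝ) 1)
    (ht : t ∈ Icc (0 : ℝ) 1) (hst : s ≤ t) (L : ℕ) : κ^[L] s ≤ κ^[L] t := by
  induction L with
  | zero => exact hst
  | succ L ih =>
    rw [Function.iterate_succ_apply', Function.iterate_succ_apply']
    exact hκ.monotoneOn (hκ.iterate_nonneg_of_nonneg hs L) (hκ.iterate_nonneg_of_nonneg ht L) ih

/-- A bound uniform in the argument: once all orbits are in `[0, 1]`, they are closer to `1` than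
the orbit of `0`. -/
theorem exists_sparse_le (hκ : IsCovarianceKernel κ J) (h1 : derivAtOne κ = 1) {c ρ : ℝ}
    (hreg : CovarianceRegularity κ c ρ) :
    ∃ K : ℝ, ∀ᶠ L : ℕ in atTop, ∀ t ∈ Icc (-1 : ℝ) 1,
      (L : ℝ) ^ (1 / (ρ - 1)) * (1 - κ^[L] t) ≤ K := by
  obtain ⟨N, hN⟩ := hκ.exists_iterate_nonneg h1
  obtain ⟨l, hl⟩ := hκ.tendsto_sparse h1 hreg (t := 0) (by simp)
  obtain ⟨K, hK⟩ := hl.bddAbove_range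
  have hp : 0 ≤ 1 / (ρ - 1) := one_div_nonneg.2 (by linarith [hreg.one_lt])
  refine ⟨((N + 1 : ℕ) : ℝ) ^ (1 / (ρ - 1)) * K, ?_⟩
  filter_upwards [eventually_ge_atTop (N + 1)] with L hL t ht
  obtain ⟨k, rfl⟩ := Nat.exists_eq_add_of_le' hL
  have hsplit : k + (N + 1) = (k + 1) + N := by ring
  have h2 : κ^[k + 1] 0 ≤ κ^[k + (N + 1)] t := by
    rw [hsplit, Function.iterate_add_apply κ (k + 1) N t]
    exact hκ.iterate_le_iterate (by simp) (hN t ht) (hN t ht).1 _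
  have h3 : ((k + (N + 1) : ℕ) : ℝ) ≤ ((N + 1 : ℕ) : ℝ) * ((k + 1 : ℕ) : ℝ) := by
    push_cast
    nlinarith [(Nat.cast_nonneg k : (0 : ℝ) ≤ k), (Nat.cast_nonneg N : (0 : ℝ) ≤ N)]
  calc ((k + (N + 1) : ℕ) : ℝ) ^ (1 / (ρ - 1)) * (1 - κ^[k + (N + 1)] t)
      ≤ (((N + 1 : ℕ) : ℝ) * ((k + 1 : ℕ) : ℝ)) ^ (1 / (ρ - 1)) * (1 - κ^[k + 1] 0) :=
        mul_le_mul (Real.rpow_le_rpow (by positivity) h3 hp) (by linarith)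
          (hκ.one_sub_iterate_nonneg ht _) (by positivity)
    _ = ((N + 1 : ℕ) : ℝ) ^ (1 / (ρ - 1)) *
          (((k + 1 : ℕ) : ℝ) ^ (1 / (ρ - 1)) * (1 - κ^[k + 1] 0)) := by
        rw [Real.mul_rpow (by positivity) (by positivity), mul_assoc]
    _ ≤ _ := mul_le_mul_of_nonneg_left (hK ⟨k + 1, rfl⟩) (by positivity)

end IsCovarianceKernel

/-! ### Almost sure limits of centered Gaussian variables -/

section GaussianLimit

variable {Ω : Type*} [MeasurableSpace Ω] {P : Measure Ω}

/-- An almost sure limit of centered Gaussian variables with convergent variances is a centered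
Gaussian variable, by convergence of the characteristic functions. -/
theorem map_eq_gaussianReal_of_tendsto [IsProbabilityMeasure P] {Y : ℕ → Ω → ℝ} {Z : Ω → ℝ}
    {σ : ℕ → NNReal} {s : NNReal} (hYm : ∀ n, AEMeasurable (Y n) P) (hZm : AEMeasurable Z P)
    (hY : ∀ n, P.map (Y n) = gaussianReal 0 (σ n))
    (hYZ : ∀ᵐ ω ∂P, Tendsto (fun n => Y n ω) atTop (𝓝 (Z ω)))
    (hσ : Tendsto σ atTop (𝓝 s)) : P.map Z = gaussianReal 0 s := by
  have : IsProbabilityMeasure (P.map Z) := Measure.isProbabilityMeasure_map hZm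
  refine Measure.ext_of_charFun (funext fun t => ?_)
  have hchar : ∀ {W : Ω → ℝ}, AEMeasurable W P →
      charFun (P.map W) t = ∫ ω, Complex.exp (t * W ω * Complex.I) ∂P := fun {W} hW => by
    rw [charFun_apply_real, integral_map hW]
    exact Continuous.aestronglyMeasurable (by fun_prop)
  have h1 : Tendsto (fun n => charFun (P.map (Y n)) t) atTop (𝓝 (charFun (P.map Z) t)) := by
    simp only [hchar (hYm _), hchar hZm]
    refine tendsto_integral_of_dominated_convergence (fun _ => 1) (fun n => ?_)
      (integrable_const 1) (fun n => Eventually.of_forall fun ω => ?_) ?_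
    · exact (by fun_prop : Continuous fun x : ℝ => Complex.exp (t * x * Complex.I)).measurable
        |>.comp_aemeasurable (hYm n) |>.aestronglyMeasurable
    · rw [← Complex.ofReal_mul, Complex.norm_exp_ofReal_mul_I]
    · filter_upwards [hYZ] with ω hω
      exact ((by fun_prop : Continuous fun x : ℝ => Complex.exp (t * x * Complex.I)).tendsto _).comp
        hω
  have h2 : Tendsto (fun n => charFun (P.map (Y n)) t) atTop (𝓝 (charFun (gaussianReal 0 s) t)) := by
    simp only [hY, charFun_gaussianReal]
    have h3 : Tendsto (fun n => ((σ n : ℝ) : ℂ)) atTop (𝓝 ((s : ℝ) : ℂ)) :=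
      ((Complex.continuous_ofReal.comp NNReal.continuous_coe).tendsto s).comp hσ
    exact (Complex.continuous_exp.tendsto _).comp
      (tendsto_const_nhds.sub ((h3.mul_const _).div_const _))
  exact tendsto_nhds_unique h1 h2

theorem lintegral_exp_mul_of_map_eq_gaussianReal {Z : Ω → ℝ} {s : NNReal}
    (hZ : P.map Z = gaussianReal 0 s) (t : ℝ) :
    ∫⁻ ω, ENNReal.ofReal (Real.exp (t * Z ω)) ∂P = ENNReal.ofReal (Real.exp (s * t ^ 2 / 2)) := by
  have h1 := mgf_gaussianReal hZ t
  rw [zero_mul, zero_add] at h1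
  have hint : Integrable (fun ω => Real.exp (t * Z ω)) P := by
    by_contra h
    rw [mgf, integral_undef h] at h1
    exact (Real.exp_pos _).ne h1
  rw [← ofReal_integral_eq_lintegral_ofReal hint (Eventually.of_forall fun _ => (Real.exp_pos _).le),
    ← h1, mgf]

theorem variance_sum_mul [IsProbabilityMeasure P] {S : Type*} {X : S → Ω → ℝ}
    (hX : ∀ z, MemLp (X z) 2 P) {K : S → S → ℝ} (hK : ∀ y z, cov[X y, X z; P] = K y z)
    {ι : Type*} [Fintype ι] (c : ι → ℝ) (p : ι → S) :
    Var[fun ω => ∑ a, c a * X (p a) ω; P] = ∑ a, c a * ∑ b, c b * K (p a) (p b) := by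
  have hmem : ∀ a, MemLp (fun ω => c a * X (p a) ω) 2 P := fun a => (hX (p a)).const_mul (c a)
  rw [← covariance_self (memLp_finsetSum _ fun a _ => hmem a).aemeasurable,
    covariance_fun_sum_fun_sum hmem hmem]
  simp only [covariance_const_mul_left, covariance_const_mul_right, hK, Finset.mul_sum]
  exact Finset.sum_congr rfl fun a _ => Finset.sum_congr rfl fun b _ => by ring

/-- A finite linear combination of the values of a centered Gaussian process is a centered Gaussian
variable, whose variance is given by the covariance kernel. -/
theorem map_sum_mul_eq_gaussianReal {S : Type*} {X : S → Ω → ℝ} (hX : IsGaussianProcess X P)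
    (h0 : ∀ z, ∫ ω, X z ω ∂P = 0) {K : S → S → ℝ} (hK : ∀ y z, cov[X y, X z; P] = K y z)
    {ι : Type*} [Fintype ι] (c : ι → ℝ) (p : ι → S) :
    P.map (fun ω => ∑ a, c a * X (p a) ω) =
      gaussianReal 0 (∑ a, c a * ∑ b, c b * K (p a) (p b)).toNNReal := by
  have hprob := hX.isProbabilityMeasure
  have hmem : ∀ z, MemLp (X z) 2 P := fun z => (hX.hasGaussianLaw_eval z).memLp_two
  have hg : HasGaussianLaw (fun ω => ∑ a, c a * X (p a) ω) P :=
    ((hX.comp_right p).smul c).hasGaussianLaw_fun_sum (I := Finset.univ)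
  have hmean : ∫ ω, ∑ a, c a * X (p a) ω ∂P = 0 := by
    rw [integral_finsetSum _ fun a _ => ((hmem (p a)).integrable (by norm_num)).const_mul (c a)]
    simp [integral_const_mul, h0]
  rw [hg.map_eq_gaussianReal, hmean, variance_sum_mul hmem hK]

end GaussianLimit

/-! ### The vector centered at the spherical average -/

/-- The linear functional `F ↦ ∑ θ_i F(x_i) - (∑ θ_i) (average of F ∘ π)` on functions on the
sphere. For `π = id` it takes a path of the field to the combination, with coefficients `θ`, of the
coordinates of the centered vector; for `π` a simple function it is a finite combination of
evaluations. -/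
noncomputable def centeredFunctional {d m : ℕ} (θ : Fin m → ℝ) (x : Fin m → UnitSphere d)
    (π : UnitSphere d → UnitSphere d) (F : UnitSphere d → ℝ) : ℝ :=
  ∑ i, θ i * F (x i) - (∑ i, θ i) / sphereArea d * ∫ y, F (π y) ∂(surfaceMeasure d)

/-- Simple functions from the sphere to itself which approximate the identity. -/
noncomputable def sphereApprox (d n : ℕ) : SimpleFunc (UnitSphere d) (UnitSphere d) :=
  SimpleFunc.approxOn id measurable_id univ (Classical.arbitrary _) (mem_univ _) n

theorem tendsto_sphereApprox {d : ℕ} (y : UnitSphere d) :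
    Tendsto (fun n => sphereApprox d n y) atTop (𝓝 y) :=
  SimpleFunc.tendsto_approxOn measurable_id (mem_univ _) (by simp)

theorem integral_comp_simpleFunc {d : ℕ} (π : SimpleFunc (UnitSphere d) (UnitSphere d))
    (F : UnitSphere d → ℝ) :
    ∫ y, F (π y) ∂(surfaceMeasure d) =
      ∑ z : π.range, (surfaceMeasure d).real (π ⁻¹' {z.1}) * F z.1 := by
  have h : ∀ y, F (π y) = ∑ z ∈ π.range, (π ⁻¹' {z}).indicator (fun _ => F z) y := fun y => by
    rw [Finset.sum_eq_single (π y)]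
    · rw [indicator_of_mem (by simp)]
    · intro z _ hz
      rw [indicator_of_notMem]
      exact fun h => hz h.symm
    · exact fun h => absurd (π.mem_range_self y) h
  simp only [h]
  rw [integral_finsetSum _ fun z _ => (integrable_const (F z)).indicator (π.measurableSet_fiber z),
    ← Finset.sum_coe_sort]
  refine Finset.sum_congr rfl fun z _ => ?_
  rw [integral_indicator_const _ (π.measurableSet_fiber z.1), smul_eq_mul]

theorem exists_centeredFunctional_eq_sum {d m : ℕ} (θ : Fin m → ℝ) (x : Fin m → UnitSphere d)
    (π : SimpleFunc (UnitSphere d) (UnitSphere d)) :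
    ∃ (c : Fin m ⊕ π.range → ℝ) (p : Fin m ⊕ π.range → UnitSphere d),
      ∀ F, centeredFunctional θ x π F = ∑ a, c a * F (p a) := by
  refine ⟨Sum.elim θ fun z => -((∑ i, θ i) / sphereArea d *
    (surfaceMeasure d).real (π ⁻¹' {z.1})), Sum.elim x Subtype.val, fun F => ?_⟩
  rw [centeredFunctional, integral_comp_simpleFunc, Fintype.sum_sum_type]
  simp [Finset.mul_sum, mul_assoc, sub_eq_add_neg]

/-- The approximating functionals converge along functions that converge continuously, that is,
along convergent sequences of points. -/
theorem tendsto_centeredFunctional {d m : ℕ} (θ : Fin m → ℝ) (x : Fin m → UnitSphere d)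
    {F : ℕ → UnitSphere d → ℝ} {G : UnitSphere d → ℝ} {K : ℝ} (hK : ∀ n z, |F n z| ≤ K)
    (h : ∀ (z : ℕ → UnitSphere d) (w : UnitSphere d), Tendsto z atTop (𝓝 w) →
      Tendsto (fun n => F n (z n)) atTop (𝓝 (G w))) :
    Tendsto (fun n => centeredFunctional θ x (sphereApprox d n) (F n)) atTop
      (𝓝 (centeredFunctional θ x id G)) := by
  refine Tendsto.sub ?_ (Tendsto.const_mul _ ?_)
  · exact tendsto_finsetSum _ fun i _ => (h (fun _ => x i) (x i) tendsto_const_nhds).const_mul _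
  · refine tendsto_integral_of_dominated_convergence (fun _ => K) (fun n => ?_)
      (integrable_const K) (fun n => Eventually.of_forall fun y => hK n _)
      (Eventually.of_forall fun y => h _ _ (tendsto_sphereApprox y))
    exact ((sphereApprox d n).map (F n)).aestronglyMeasurable

theorem abs_centeredFunctional_le {d m : ℕ} (θ : Fin m → ℝ) (x : Fin m → UnitSphere d)
    (π : UnitSphere d → UnitSphere d) {F : UnitSphere d → ℝ} {K : ℝ} (hF : ∀ z, |F z| ≤ K) :
    |centeredFunctional θ x π F| ≤
      ∑ i, |θ i| * K + |(∑ i, θ i) / sphereArea d| * (K * sphereArea d) := by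
  refine (abs_sub _ _).trans (add_le_add ((Finset.abs_sum_le_sum_abs _ _).trans
    (Finset.sum_le_sum fun i _ => ?_)) ?_)
  · rw [abs_mul]
    exact mul_le_mul_of_nonneg_left (hF _) (abs_nonneg _)
  · rw [abs_mul]
    refine mul_le_mul_of_nonneg_left ?_ (abs_nonneg _)
    exact norm_integral_le_of_norm_le_const (f := fun y => F (π y))
      (Eventually.of_forall fun y => hF (π y))

theorem dotProduct_centeredVector {Ω : Type*} {d m : ℕ} (T : UnitSphere d → Ω → ℝ)
    (x : Fin m → UnitSphere d) (θ : Fin m → ℝ) (ω : Ω) :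
    dotProduct θ (centeredVector T x ω) = centeredFunctional θ x id fun y => T y ω := by
  have hpos := sphereArea_pos d
  have hcoeff : coeffZero T ω / √(sphereArea d) =
      (∫ y, T y ω ∂(surfaceMeasure d)) / sphereArea d := by
    rw [coeffZero, integral_mul_const, div_eq_mul_inv, mul_assoc, ← mul_inv,
      Real.mul_self_sqrt hpos.le, div_eq_mul_inv]
  simp only [dotProduct, centeredVector, centeredFunctional, hcoeff, mul_sub, id,
    Finset.sum_sub_distrib, ← Finset.sum_mul]
  ring

theorem sphereInner_mem_Icc {d : ℕ} (x y : UnitSphere d) : sphereInner x y ∈ Icc (-1 : ℝ) 1 := by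
  have h := abs_real_inner_le_norm (x : EuclideanSpace ℝ (Fin (d + 1)))
    (y : EuclideanSpace ℝ (Fin (d + 1)))
  rw [mem_sphere_zero_iff_norm.1 x.2, mem_sphere_zero_iff_norm.1 y.2, one_mul] at h
  exact abs_le.1 h

theorem sphereInner_comm {d : ℕ} (x y : UnitSphere d) : sphereInner x y = sphereInner y x :=
  real_inner_comm _ _

theorem continuous_comp_sphereInner {d : ℕ} {k : ℝ → ℝ} (hk : ContinuousOn k (Icc (-1) 1)) :
    Continuous fun p : UnitSphere d × UnitSphere d => k (sphereInner p.1 p.2) :=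
  hk.comp_continuous continuous_sphereInner fun p => sphereInner_mem_Icc p.1 p.2

/-- The variance of the limit: subtracting the spherical average subtracts from the kernel its
weighted average. -/
theorem centeredFunctional_centeredFunctional {d m : ℕ} (hd : 1 ≤ d) (θ : Fin m → ℝ)
    (x : Fin m → UnitSphere d) {k : ℝ → ℝ} (hk : ContinuousOn k (Icc (-1) 1)) :
    centeredFunctional θ x id (fun y => centeredFunctional θ x id fun z => k (sphereInner y z)) =
      ∑ i, θ i * ∑ j, θ j * (k (sphereInner (x i) (x j)) - weightedAverage d k) := by
  have hpos := (sphereArea_pos d).ne'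
  have hin : ∀ y, (centeredFunctional θ x id fun z => k (sphereInner y z)) =
      ∑ j, θ j * (k (sphereInner y (x j)) - weightedAverage d k) := fun y => by
    simp only [centeredFunctional, id, integral_comp_sphereInner hd y hk, mul_sub,
      Finset.sum_sub_distrib, ← Finset.sum_mul]
    field_simp
  have hout : ∫ y, ∑ j, θ j * (k (sphereInner y (x j)) - weightedAverage d k)
      ∂(surfaceMeasure d) = 0 := by
    have hint : ∀ j, Integrable (fun y => k (sphereInner y (x j))) (surfaceMeasure d) := fun j =>
      ((continuous_comp_sphereInner hk).comp (Continuous.prodMk_left (x j))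
        |>.integrable_of_hasCompactSupport (HasCompactSupport.of_compactSpace _))
    have hint' : ∀ j, Integrable (fun y => k (sphereInner y (x j)) - weightedAverage d k)
        (surfaceMeasure d) := fun j => (hint j).sub (integrable_const _)
    rw [integral_finsetSum _ fun j _ => (hint' j).const_mul (θ j)]
    refine Finset.sum_eq_zero fun j _ => ?_
    rw [integral_const_mul, integral_sub (hint j) (integrable_const _)]
    simp only [sphereInner_comm _ (x j)]
    rw [integral_comp_sphereInner hd (x j) hk, integral_const, smul_eq_mul, ← sphereArea, sub_self,
      mul_zero]
  simp only [hin]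
  rw [centeredFunctional]
  simp only [id, hout, mul_zero, sub_zero]

namespace IsIsotropicGaussianField

variable {Ω : Type*} [MeasurableSpace Ω] {P : Measure Ω} {d m : ℕ} {T : UnitSphere d → Ω → ℝ}
  {k : ℝ → ℝ}

/-- Riemann sums of a continuous path converge to its integral. -/
theorem ae_tendsto_centeredFunctional (hT : IsIsotropicGaussianField P T k) (θ : Fin m → ℝ)
    (x : Fin m → UnitSphere d) : ∀ᵐ ω ∂P, Tendsto
      (fun n => centeredFunctional θ x (sphereApprox d n) fun y => T y ω) atTop
      (𝓝 (dotProduct θ (centeredVector T x ω))) := by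
  filter_upwards [hT.continuous_paths] with ω hω
  rw [dotProduct_centeredVector]
  obtain ⟨K, hK⟩ := isCompact_univ.exists_bound_of_continuousOn hω.continuousOn
  exact tendsto_centeredFunctional θ x (F := fun _ y => T y ω) (fun _ z => hK z (mem_univ z))
    fun z w hz => (hω.tendsto w).comp hz

theorem aemeasurable_centeredFunctional (hT : IsIsotropicGaussianField P T k) (θ : Fin m → ℝ)
    (x : Fin m → UnitSphere d) (n : ℕ) :
    AEMeasurable (fun ω => centeredFunctional θ x (sphereApprox d n) fun y => T y ω) P := by
  obtain ⟨c, p, hcp⟩ := exists_centeredFunctional_eq_sum θ x (sphereApprox d n)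
  simp only [hcp]
  exact Finset.aemeasurable_fun_sum _ fun a _ =>
    (hT.isGaussianProcess.aemeasurable (p a)).const_mul (c a)

theorem aemeasurable_dotProduct_centeredVector (hT : IsIsotropicGaussianField P T k)
    (θ : Fin m → ℝ) (x : Fin m → UnitSphere d) :
    AEMeasurable (fun ω => dotProduct θ (centeredVector T x ω)) P :=
  aemeasurable_of_tendsto_metrizable_ae' (hT.aemeasurable_centeredFunctional θ x)
    (hT.ae_tendsto_centeredFunctional θ x)

theorem aemeasurable_centeredVector (hT : IsIsotropicGaussianField P T k)
    (x : Fin m → UnitSphere d) : AEMeasurable (centeredVector T x) P :=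
  aemeasurable_pi_iff.2 fun i => by
    simpa using hT.aemeasurable_dotProduct_centeredVector (Pi.single i 1) x

theorem tendsto_centeredFunctional_centeredFunctional (hd : 1 ≤ d)
    (hk : ContinuousOn k (Icc (-1) 1)) (θ : Fin m → ℝ) (x : Fin m → UnitSphere d) :
    Tendsto (fun n => centeredFunctional θ x (sphereApprox d n) fun y =>
      centeredFunctional θ x (sphereApprox d n) fun z => k (sphereInner y z)) atTop
      (𝓝 (∑ i, θ i * ∑ j, θ j * (k (sphereInner (x i) (x j)) - weightedAverage d k))) := by
  have hcont := continuous_comp_sphereInner (d := d) hk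
  obtain ⟨K, hK⟩ := isCompact_univ.exists_bound_of_continuousOn hcont.continuousOn
  have hK' : ∀ y z : UnitSphere d, |k (sphereInner y z)| ≤ K := fun y z => hK (y, z) (mem_univ _)
  rw [← centeredFunctional_centeredFunctional hd θ x hk]
  refine tendsto_centeredFunctional θ x (F := fun n y =>
    centeredFunctional θ x (sphereApprox d n) fun z => k (sphereInner y z))
    (fun n y => abs_centeredFunctional_le θ x _ (hK' y)) fun y w hy => ?_
  refine tendsto_centeredFunctional θ x (F := fun n z => k (sphereInner (y n) z))
    (G := fun z => k (sphereInner w z)) (fun n z => hK' (y n) z) fun z w' hz => ?_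
  have h := (hcont.tendsto (w, w')).comp (hy.prodMk_nhds hz)
  exact h

theorem sum_mul_sum_mul_sub_weightedAverage_nonneg (hT : IsIsotropicGaussianField P T k)
    (hd : 1 ≤ d) (hk : ContinuousOn k (Icc (-1) 1)) (θ : Fin m → ℝ) (x : Fin m → UnitSphere d) :
    0 ≤ ∑ i, θ i * ∑ j, θ j * (k (sphereInner (x i) (x j)) - weightedAverage d k) := by
  have hprob := hT.isGaussianProcess.isProbabilityMeasure
  refine ge_of_tendsto' (tendsto_centeredFunctional_centeredFunctional hd hk θ x) fun n => ?_
  obtain ⟨c, p, hcp⟩ := exists_centeredFunctional_eq_sum θ x (sphereApprox d n)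
  simp only [hcp]
  rw [← variance_sum_mul (fun z => (hT.isGaussianProcess.hasGaussianLaw_eval z).memLp_two)
    hT.covariance]
  exact variance_nonneg _ _

/-- The linear combinations of the coordinates of the centered vector are Gaussian. -/
theorem map_dotProduct_centeredVector (hT : IsIsotropicGaussianField P T k)
    (hd : 1 ≤ d) (hk : ContinuousOn k (Icc (-1) 1)) (θ : Fin m → ℝ) (x : Fin m → UnitSphere d) :
    P.map (fun ω => dotProduct θ (centeredVector T x ω)) = gaussianReal 0
      (∑ i, θ i * ∑ j, θ j *
        (k (sphereInner (x i) (x j)) - weightedAverage d k)).toNNReal := by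
  have hprob := hT.isGaussianProcess.isProbabilityMeasure
  refine map_eq_gaussianReal_of_tendsto (hT.aemeasurable_centeredFunctional θ x)
    (hT.aemeasurable_dotProduct_centeredVector θ x) (fun n => ?_)
    (hT.ae_tendsto_centeredFunctional θ x) ((continuous_real_toNNReal.tendsto _).comp
      (tendsto_centeredFunctional_centeredFunctional hd hk θ x))
  obtain ⟨c, p, hcp⟩ := exists_centeredFunctional_eq_sum θ x (sphereApprox d n)
  simp only [hcp, Function.comp_apply]
  exact map_sum_mul_eq_gaussianReal hT.isGaussianProcess hT.centered hT.covariance c p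

theorem lintegral_exp_mul_dotProduct_centeredVector (hT : IsIsotropicGaussianField P T k)
    (hd : 1 ≤ d) (hk : ContinuousOn k (Icc (-1) 1)) (θ : Fin m → ℝ) (x : Fin m → UnitSphere d)
    (v : ℝ) :
    ∫⁻ ω, ENNReal.ofReal (Real.exp (v * dotProduct θ (centeredVector T x ω))) ∂P =
      ENNReal.ofReal (Real.exp (v * (1 / 2 * ∑ i, θ i * ∑ j,
        v * (k (sphereInner (x i) (x j)) - weightedAverage d k) * θ j))) := by
  rw [lintegral_exp_mul_of_map_eq_gaussianReal (hT.map_dotProduct_centeredVector hd hk θ x),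
    Real.coe_toNNReal _ (hT.sum_mul_sum_mul_sub_weightedAverage_nonneg hd hk θ x)]
  have h : ∑ i, θ i * ∑ j, v * (k (sphereInner (x i) (x j)) - weightedAverage d k) * θ j =
      v * ∑ i, θ i * ∑ j, θ j * (k (sphereInner (x i) (x j)) - weightedAverage d k) := by
    simp only [Finset.mul_sum]
    exact Finset.sum_congr rfl fun i _ => Finset.sum_congr rfl fun j _ => by ring
  rw [h]
  congr 2
  ring

end IsIsotropicGaussianField

/-! ### Convergence of the weighted averages -/

theorem intervalIntegrable_mul_sphereWeight {d : ℕ} (hd : 1 ≤ d) {f : ℝ → ℝ} {K : ℝ}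
    (hf : AEStronglyMeasurable f (volume.restrict (Ioo (-1 : ℝ) 1)))
    (hK : ∀ t ∈ Ioo (-1 : ℝ) 1, |f t| ≤ K) :
    IntervalIntegrable (fun t => f t * sphereWeight d t) volume (-1) 1 := by
  rw [intervalIntegrable_iff_integrableOn_Ioo_of_le (by norm_num)]
  exact (integrableOn_sphereWeight hd).bdd_mul hf
    ((ae_restrict_mem measurableSet_Ioo).mono fun t ht => hK t ht)

theorem integral_sphereWeight_pos {d : ℕ} (hd : 1 ≤ d) :
    0 < ∫ t in (-1 : ℝ)..1, sphereWeight d t :=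
  intervalIntegral.intervalIntegral_pos_of_pos_on
    ((intervalIntegrable_iff_integrableOn_Ioo_of_le (by norm_num)).2 (integrableOn_sphereWeight hd))
    (fun _ ht => sphereWeight_pos ht) (by norm_num)

theorem weightedAverage_mul_one_sub {d : ℕ} (hd : 1 ≤ d) {f : ℝ → ℝ}
    (hf : ContinuousOn f (Icc (-1) 1)) (v : ℝ) :
    weightedAverage d (fun t => v * (1 - f t)) = v * (1 - weightedAverage d f) := by
  obtain ⟨K, hK⟩ := isCompact_Icc.exists_bound_of_continuousOn hf
  have hpos := (integral_sphereWeight_pos hd).ne'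
  have h1 : IntervalIntegrable (sphereWeight d) volume (-1) 1 :=
    (intervalIntegrable_iff_integrableOn_Ioo_of_le (by norm_num)).2 (integrableOn_sphereWeight hd)
  have h2 := intervalIntegrable_mul_sphereWeight hd
    ((hf.mono Ioo_subset_Icc_self).aestronglyMeasurable measurableSet_Ioo)
    (fun t ht => hK t (Ioo_subset_Icc_self ht))
  simp only [weightedAverage, mul_assoc, sub_mul, one_mul]
  rw [intervalIntegral.integral_const_mul, intervalIntegral.integral_sub h1 h2]
  field_simp

section Limit

variable {d : ℕ} {f : ℕ → ℝ → ℝ} {g : ℝ → ℝ} {K : ℝ}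

theorem aestronglyMeasurable_of_tendsto_on_Icc (hf : ∀ L, ContinuousOn (f L) (Icc (-1) 1))
    (hfg : ∀ t ∈ Icc (-1 : ℝ) 1, Tendsto (fun L => f L t) atTop (𝓝 (g t))) :
    AEStronglyMeasurable g (volume.restrict (Ioo (-1 : ℝ) 1)) :=
  aestronglyMeasurable_of_tendsto_ae atTop
    (fun L => ((hf L).mono Ioo_subset_Icc_self).aestronglyMeasurable measurableSet_Ioo)
    ((ae_restrict_mem measurableSet_Ioo).mono fun t ht => hfg t (Ioo_subset_Icc_self ht))

theorem tendsto_weightedAverage (hd : 1 ≤ d) (hf : ∀ L, ContinuousOn (f L) (Icc (-1) 1))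
    (hfg : ∀ t ∈ Icc (-1 : ℝ) 1, Tendsto (fun L => f L t) atTop (𝓝 (g t)))
    (hK : ∀ᶠ L in atTop, ∀ t ∈ Icc (-1 : ℝ) 1, |f L t| ≤ K) :
    Tendsto (fun L => weightedAverage d (f L)) atTop (𝓝 (weightedAverage d g)) := by
  refine Tendsto.div_const ?_ _
  simp only [intervalIntegral.integral_of_le (show (-1 : ℝ) ≤ 1 by norm_num),
    integral_Ioc_eq_integral_Ioo]
  refine tendsto_integral_filter_of_dominated_convergence (fun t => K * sphereWeight d t)
    (Eventually.of_forall fun L => ?_) ?_ ((integrableOn_sphereWeight hd).const_mul K) ?_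
  · exact (((hf L).mono Ioo_subset_Icc_self).aestronglyMeasurable measurableSet_Ioo).mul
      (measurable_sphereWeight d).aestronglyMeasurable
  · filter_upwards [hK] with L hL
    filter_upwards [ae_restrict_mem measurableSet_Ioo] with t ht
    rw [norm_mul, Real.norm_of_nonneg (sphereWeight_pos ht).le]
    exact mul_le_mul_of_nonneg_right (hL t (Ioo_subset_Icc_self ht)) (sphereWeight_pos ht).le
  · filter_upwards [ae_restrict_mem measurableSet_Ioo] with t ht
    exact (hfg t (Ioo_subset_Icc_self ht)).mul_const _

end Limit

theorem isSymm_matrixB2 {d m : ℕ} (g : ℝ → ℝ) (x : Fin m → UnitSphere d) :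
    (matrixB2 g x).IsSymm := by
  ext i j
  simp [matrixB2, sphereInner_comm (x i) (x j)]

/-! ### The large deviation principle for the centered field -/

/-- Both regimes reduce to the pointwise convergence of `v_L (1 - κ_L)` together with a bound that
is uniform on `[-1, 1]`. -/
theorem centeredFieldLDP_of_tendsto {Ω : Type*} [MeasurableSpace Ω] {P : Measure Ω}
    [IsProbabilityMeasure P] {d m : ℕ} (hd : 1 ≤ d) {κ : ℝ → ℝ} {J : ℕ → ℝ}
    (hκ : IsCovarianceKernel κ J) {T : ℕ → UnitSphere d → Ω → ℝ}
    (hT : ∀ L : ℕ, 1 ≤ L → IsIsotropicGaussianField P (T L) (κ^[L])) (x : Fin m → UnitSphere d)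
    {v : ℕ → ℝ} (hv : Tendsto v atTop atTop)
    (hlim : ∀ t ∈ Icc (-1 : ℝ) 1, ∃ l, Tendsto (fun L : ℕ => v L * (1 - κ^[L] t)) atTop (𝓝 l))
    {K : ℝ} (hK : ∀ᶠ L : ℕ in atTop, ∀ t ∈ Icc (-1 : ℝ) 1, v L * (1 - κ^[L] t) ≤ K) :
    CenteredFieldLDP P T κ x v := by
  have hg : ∀ t ∈ Icc (-1 : ℝ) 1,
      Tendsto (fun L : ℕ => v L * (1 - κ^[L] t)) atTop (𝓝 (limitFunction κ v t)) :=
    fun t ht => tendsto_nhds_limUnder (hlim t ht)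
  have hcont : ∀ L : ℕ, ContinuousOn (fun t => v L * (1 - κ^[L] t)) (Icc (-1) 1) := fun L =>
    (continuousOn_const.sub (hκ.continuousOn_iterate L)).const_mul (v L)
  have hK' : ∀ᶠ L : ℕ in atTop, ∀ t ∈ Icc (-1 : ℝ) 1, |v L * (1 - κ^[L] t)| ≤ K := by
    filter_upwards [hK, hv.eventually_ge_atTop 0] with L hL hvL t ht
    rw [abs_of_nonneg (mul_nonneg hvL (hκ.one_sub_iterate_nonneg ht L))]
    exact hL t ht
  have hgK : ∀ t ∈ Ioo (-1 : ℝ) 1, |limitFunction κ v t| ≤ K := fun t ht =>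
    le_of_tendsto (hg t (Ioo_subset_Icc_self ht)).abs
      (hK'.mono fun L hL => hL t (Ioo_subset_Icc_self ht))
  have havg := tendsto_weightedAverage hd hcont hg hK'
  refine ⟨hg, intervalIntegrable_mul_sphereWeight hd
    (aestronglyMeasurable_of_tendsto_on_Icc hcont hg) hgK, isGoodRateFunction_quadraticLegendre _,
    satisfiesLDP_quadraticLegendre (q := fun L θ => 1 / 2 * ∑ i, θ i * ∑ j,
      v L * (κ^[L] (sphereInner (x i) (x j)) - weightedAverage d κ^[L]) * θ j)
      (isSymm_matrixB2 _ x) hv ?_ ?_ fun θ => ?_⟩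
  · filter_upwards [eventually_ge_atTop 1] with L hL
    exact (hT L hL).aemeasurable_centeredVector x
  · filter_upwards [eventually_ge_atTop 1] with L hL θ
    exact (hT L hL).lintegral_exp_mul_dotProduct_centeredVector hd (hκ.continuousOn_iterate L) θ x _
  · refine Tendsto.const_mul _ (tendsto_finsetSum _ fun i _ => Tendsto.const_mul _
      (tendsto_finsetSum _ fun j _ => Tendsto.mul_const _ ?_))
    refine (havg.sub (hg _ (sphereInner_mem_Icc (x i) (x j)))).congr fun L => ?_
    rw [weightedAverage_mul_one_sub hd (hκ.continuousOn_iterate L)]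
    ring

theorem theorem3p2 {Ω : Type*} [MeasurableSpace Ω] (P : Measure Ω) [IsProbabilityMeasure P]
    (d : ℕ) (hd : 1 ≤ d) (κ : ℝ → ℝ) (J : ℕ → ℝ) (hκ : IsCovarianceKernel κ J)
    (T : ℕ → UnitSphere d → Ω → ℝ)
    (hT : ∀ L : ℕ, 1 ≤ L → IsIsotropicGaussianField P (T L) (κ^[L]))
    (m : ℕ) (hm : 1 ≤ m) (x : Fin m → UnitSphere d) (hx : Function.Injective x) :
    (derivAtOne κ < 1 →
      CenteredFieldLDP P T κ x (fun L : ℕ => (derivAtOne κ ^ L)⁻¹)) ∧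
    (derivAtOne κ = 1 → ∀ c ρ : ℝ, CovarianceRegularity κ c ρ →
      CenteredFieldLDP P T κ x (fun L : ℕ => (L : ℝ) ^ (1 / (ρ - 1)))) := by
  refine ⟨fun h => ?_, fun h c ρ hreg => ?_⟩
  · refine centeredFieldLDP_of_tendsto hd hκ hT x ?_ (fun t ht => hκ.tendsto_low_disorder ht)
      (Eventually.of_forall fun L t ht => hκ.low_disorder_le ht L)
    simp only [← inv_pow]
    exact tendsto_pow_atTop_atTop_of_one_lt ((one_lt_inv₀ hκ.derivAtOne_pos).2 h)
  · obtain ⟨K, hK⟩ := hκ.exists_sparse_le h hreg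
    refine centeredFieldLDP_of_tendsto hd hκ hT x ?_ (fun t ht => hκ.tendsto_sparse h hreg ht) hK
    exact (tendsto_rpow_atTop (one_div_pos.2 (sub_pos.2 hreg.one_lt))).comp
      tendsto_natCast_atTop_atTop
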